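/- For $n,d\ge 1$ let $A=A_n=P^{(1)}+\dots+P^{(d)}$, where $P^{(1)},\dots,P^{(d)}$ are independent uniformly distributed random $n\times n$ permutation matrices. For $I\subseteq[n]$ let $A(I)=(A_{ij})_{i,j\in I}$ and let $\Delta_k=\Delta_k^{(n)}=\sum_{I\subseteq[n],\,|I|=k}\det A(I)$ be the secular coefficients (so $\Delta_0=1$). Let $\widehat\chi_n(z)=\frac1{\sqrt d}\det\bigl(I_n-z\frac{A}{\sqrt d}\bigr)$, and let $H(D_1)$ be the space of analytic functions on $D_1=\{z\in\mathbb C:|z|<1\}$ with the topology of uniform convergence on compact subsets. (1) For all $n\ge 2$, $0<r<1$ and all integers $1\le d<\sqrt{n(1-r)/r}$, $$\sum_{k=0}^{n}\frac{r^k}{d^{k+1}}\,\mathbb E|\Delta_k|^2\le\frac{\frac2d+r}{\bigl(1-r-\frac{rd^2}{n}\bigr)^2},$$ $$\sum_{k=1}^{n}\frac{r^k}{d^{k}}\sum_{|I|=k}\mathbb E\bigl[\det(A(I))^2\bigr]\le\frac{2}{1-r-\frac{rd^2}{n}},$$ $$\sum_{k=1}^{n}\frac{r^k}{d^{k+1}}\Bigl|\sum_{\substack{|I|=|J|=k\\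 |I\cap J|=k-1}}\mathbb E\bigl[\det A(I)\,\det A(J)\bigr]\Bigr|\le\frac{r}{\bigl(1-r-\frac{rd^2}{n}\bigr)^2},$$ where $I,J$ range over subsets of $[n]$. (2) Let $d(n)\ge1$ be integers with $d(n)=o(\sqrt n)$ as $n\to\infty$, and take $d=d(n)$ in the definition of $A_n$ and $\widehat\chi_n$ (the $A_n$ may be defined on different probability spaces). Then $(\widehat\chi_n)_n$ is tight in $H(D_1)$: for every $\varepsilon>0$ there is a compact $K\subset H(D_1)$ with $\mathbb P(\widehat\chi_n\in K)>1-\varepsilon$ for all sufficiently large $n$. Moreover $(\widehat\chi_n)_n$, and likewise each of its subsequences, admits a subsequence that converges in law to a random element of $H(D_1)$. -/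

import Mathlib

open MeasureTheory ProbabilityTheory Filter Topology

universe u

/-- `π 0, …, π (d-1)` are independent uniformly distributed random permutations of `Fin n`
(the finite group of permutations carries the discrete sigma-algebra). -/
structure IsIIDUniformPerms {Ω : Type u} [MeasurableSpace Ω] (P : Measure Ω) {n d : ℕ}
    (π : Fin d → Ω → Equiv.Perm (Fin n)) : Prop where
  measurable : ∀ q, @Measurable Ω (Equiv.Perm (Fin n)) _ ⊤ (π q)
  indep : iIndepFun (m := fun _ : Fin d => (⊤ : MeasurableSpace (Equiv.Perm (Fin n)))) π P
  uniform : ∀ q σ, P {ω | π q ω = σ} = ((n.factorial : ℕ) : ENNReal)⁻¹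

/-- The sum of the permutation matrices `(1_{σ q i = j})_{i,j}` of the permutations `σ q`. -/
noncomputable def permMatrixSum {n d : ℕ} (σ : Fin d → Equiv.Perm (Fin n)) :
    Matrix (Fin n) (Fin n) ℝ :=
  ∑ q, (σ q).permMatrix ℝ

/-- The principal minor `det A(I)`, where `A(I) = (A i j)_{i,j ∈ I}`. -/
noncomputable def principalMinor {n : ℕ} (A : Matrix (Fin n) (Fin n) ℝ)
    (I : Finset (Fin n)) : ℝ :=
  (A.submatrix (fun i : I => (i : Fin n)) (fun j : I => (j : Fin n))).det

/-- The secular coefficient `Δ_k`: the sum of all principal minors of size `k`. -/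
noncomputable def secularCoeff {n : ℕ} (A : Matrix (Fin n) (Fin n) ℝ) (k : ℕ) : ℝ :=
  ∑ I ∈ Finset.powersetCard k (Finset.univ : Finset (Fin n)), principalMinor A I

/-- The rescaled characteristic polynomial `z ↦ d^{-1/2} det (1 - z A / d^{1/2})`. -/
noncomputable def rescaledCharpoly {n : ℕ} (d : ℕ) (A : Matrix (Fin n) (Fin n) ℝ) (z : ℂ) : ℂ :=
  1 / ((Real.sqrt d : ℝ) : ℂ) *
    (1 - (z / ((Real.sqrt d : ℝ) : ℂ)) • A.map (fun x : ℝ => (x : ℂ))).det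

/-- The open unit disk. -/
abbrev unitDisk : Set ℂ := Metric.ball (0 : ℂ) 1

/-- The space of analytic functions on the open unit disk. -/
def HolDisk : Type :=
  {f : C(unitDisk, ℂ) // ∃ g : ℂ → ℂ, AnalyticOnNhd ℂ g unitDisk ∧ ∀ z : unitDisk, g z = f z}

/-- `HolDisk` carries the topology of uniform convergence on compact subsets of the disk, that is,
the one induced by the compact-open topology. -/
instance HolDisk.instTopologicalSpace : TopologicalSpace HolDisk :=
  inferInstanceAs (TopologicalSpace
    {f : C(unitDisk, ℂ) // ∃ g : ℂ → ℂ, AnalyticOnNhd ℂ g unitDisk ∧ ∀ z : unitDisk, g z = f z})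

instance HolDisk.instMeasurableSpace : MeasurableSpace HolDisk := borel HolDisk

instance HolDisk.instBorelSpace : BorelSpace HolDisk := ⟨rfl⟩

theorem analyticOnNhd_rescaledCharpoly {n : ℕ} (d : ℕ) (A : Matrix (Fin n) (Fin n) ℝ) :
    AnalyticOnNhd ℂ (rescaledCharpoly d A) unitDisk := by
  apply DifferentiableOn.analyticOnNhd _ Metric.isOpen_ball
  apply Differentiable.differentiableOn
  unfold rescaledCharpoly
  simp only [Matrix.det_apply, Matrix.sub_apply, Matrix.smul_apply, smul_eq_mul, Matrix.map_apply]
  fun_prop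

/-- The rescaled characteristic polynomial as an element of the space of analytic functions on
the unit disk. -/
noncomputable def rescaledCharpolyHol {n : ℕ} (d : ℕ) (A : Matrix (Fin n) (Fin n) ℝ) : HolDisk :=
  ⟨⟨fun z => rescaledCharpoly d A z,
      (analyticOnNhd_rescaledCharpoly d A).continuousOn.domRestrict⟩,
    rescaledCharpoly d A, analyticOnNhd_rescaledCharpoly d A, fun _ => rfl⟩

/-- Tightness of a sequence of random analytic functions, `f n` being defined on the probability
space `(Ω n, P n)`: for every `ε > 0` there is a compact `K` with `P (f n ∈ K) > 1 - ε` for all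
sufficiently large `n`. -/
def IsTightSeq {Ω : ℕ → Type u} [∀ n, MeasurableSpace (Ω n)] (P : ∀ n, Measure (Ω n))
    (f : ∀ n, Ω n → HolDisk) : Prop :=
  ∀ ε : ℝ, 0 < ε → ∃ K : Set HolDisk, IsCompact K ∧
    ∀ᶠ n in atTop, 1 - ε < (P n).real {ω | f n ω ∈ K}

/-!
Write `A` for the sum of `d` independent uniform `n × n` permutation matrices, `J` for the all-ones
matrix and `C = A - (d / n) J`, which has zero row and column sums. Both laws are invariant under
permutations of the rows and under permutations of the columns (`Exchangeable`).

*From `A` to `C`.* Since `C J = 0`, one has `det (1 + X A) = (1 + d X) det (1 + X C)`, so that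
`e_k(A) = e_k(C) + d e_{k-1}(C)` for the secular coefficients `e_k`; similarly
`e_k(A Aᵀ) = e_k(C Cᵀ) + d² e_{k-1}(C Cᵀ)` (`secularCoeff_add_constMatrix`).

*Which pairs of minors are correlated.* Swapping two rows that meet `I` but not `J` shows that
`E[det A(I) det A(J)] = 0` unless `I` and `J` share all but at most one element
(`Exchangeable.expect_principalMinor_mul_eq_zero`). For `C`, averaging one row index and one column
index evaluates the remaining terms: `E[e_k(C) e_{k-1}(C)] = 0`, and
`E[det C(I) det C(J)] = E[det C(I)²] / (n - k)²` if `J` arises from `I` by exchanging one element.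
By exchangeability and the Cauchy–Binet formula, `∑_I E[det X(I)²] = E[e_k(X Xᵀ)] / binom(n, k)` for
`X = A` and `X = C`. With `p_k = E[e_k(C)²]` (`centeredMoment`) these facts give
`E[e_k(A)²] = p_k + d² p_{k-1}`, `n ∑_I E[det A(I)²] = (n - k) p_k + d² k p_{k-1}`, and, by taking the
difference, `n T_k = k p_k + d² (n - k) p_{k-1}` for the sum `T_k` over the pairs sharing `k - 1`
elements.

*The bound `p_k ≤ d^k`.* This follows from `E[det (C Cᵀ)(I)] ≤ d^k (n - k) / n` for `|I| = k`
(`expect_gram_le`), by adding rows one at a time. A new row is the sum over the `d` permutations of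
centered unit vectors `b_q`, and multiplies the Gram determinant by the squared distance of `∑ b_q`
to the span of the old rows. Given the old rows, the `b_q` are independent, and the sum of their
conditional means lies in this span. So the mixed terms contribute a nonpositive amount, while each
of the `d` diagonal terms is at most the trace of the projection onto the complement of the old rows
and of the constant vector, divided by the number `n - k` of unused rows: `(n - k - 1) / (n - k)`.

Summing geometric series gives the three bounds.

*Tightness.* The Taylor coefficients of the rescaled characteristic polynomial have second moments
at most `2`. By Markov's inequality they are bounded by `c (k + 1)` for all `k` with probability at
least `1 - 4 / c²`, and the analytic functions satisfying these bounds form a compact set, the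
continuous image of a product of closed disks. Prokhorov's theorem yields the convergent
subsequences.
-/

/-! ### The Cauchy–Binet formula and rank-one perturbations -/

namespace PermSum

open Matrix Finset

open scoped BigOperators

/-- The Cauchy–Binet formula for a Gram determinant, summed over all tuples of columns rather than
over sets of columns; each set is then counted `(card ι)!` times. -/
theorem factorial_mul_det_mul_transpose {ι m : Type*} [Fintype ι] [DecidableEq ι] [Fintype m]
    [DecidableEq m] (R : Matrix ι m ℝ) :
    ((Fintype.card ι).factorial : ℝ) * (R * Rᵀ).det
      = ∑ z : ι → m, (R.submatrix id z).det ^ 2 := by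
  have key : (R * Rᵀ).det = ∑ z : ι → m, (∏ i, R i (z i)) * (R.submatrix id z).det := by
    simp only [det_apply', mul_apply, prod_univ_sum, Fintype.piFinset_univ, mul_sum]
    rw [sum_comm]
    refine sum_congr rfl fun z _ => sum_congr rfl fun σ _ => ?_
    simp only [transpose_apply, submatrix_apply, id, prod_mul_distrib]
    ring
  have key2 (τ : Equiv.Perm ι) : (R * Rᵀ).det
      = ∑ z : ι → m, ((Equiv.Perm.sign τ : ℤ) * ∏ i, R i (z (τ i))) * (R.submatrix id z).det := by
    rw [key, ← Equiv.sum_comp (Equiv.arrowCongr τ.symm (Equiv.refl m))]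
    refine sum_congr rfl fun z _ => ?_
    have := det_permute' τ (R.submatrix id z)
    rw [submatrix_submatrix] at this
    have h2 : (Equiv.arrowCongr τ.symm (Equiv.refl m)) z = z ∘ τ := by ext i; simp
    rw [h2, show (R.submatrix id (z ∘ τ)).det = _ from this]
    simp only [Function.comp]
    ring
  have h3 : ((Fintype.card ι).factorial : ℝ) * (R * Rᵀ).det
      = ∑ _τ : Equiv.Perm ι, (R * Rᵀ).det := by
    rw [sum_const, card_univ, Fintype.card_perm, nsmul_eq_mul]
  rw [h3, sum_congr rfl fun τ _ => key2 τ, sum_comm]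
  refine sum_congr rfl fun z _ => ?_
  rw [← sum_mul, sq]
  congr 1
  rw [← det_transpose, det_apply']
  rfl

variable {n : ℕ}

theorem secularCoeff_eq_coeff (M : Matrix (Fin n) (Fin n) ℝ) (k : ℕ) :
    secularCoeff M k
      = (det (1 + (Polynomial.X : Polynomial ℝ) • M.map Polynomial.C)).coeff k := by
  rw [coeff_det_one_add_X_smul_eq_sum_minors]
  rfl

/-- The matrix all of whose entries are `c`. -/
def constMatrix (n : ℕ) (c : ℝ) : Matrix (Fin n) (Fin n) ℝ := Matrix.of fun _ _ => c

theorem det_one_add_smul_add_constMatrix {M : Matrix (Fin n) (Fin n) ℝ}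
    (hM : ∀ i, ∑ j, M i j = 0) (c : ℝ) :
    det (1 + (Polynomial.X : Polynomial ℝ) • (M + constMatrix n c).map Polynomial.C)
      = det (1 + (Polynomial.X : Polynomial ℝ) • M.map Polynomial.C)
        * (1 + Polynomial.C (n * c) * Polynomial.X) := by
  have hJ : det (1 + (Polynomial.X : Polynomial ℝ) • (constMatrix n c).map Polynomial.C)
      = 1 + Polynomial.C (n * c) * Polynomial.X := by
    have h := det_one_add_replicateCol_mul_replicateRow (ι := Unit)
      (fun _ : Fin n => (Polynomial.X : Polynomial ℝ)) (fun _ : Fin n => Polynomial.C c)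
    have e : (Polynomial.X : Polynomial ℝ) • (constMatrix n c).map Polynomial.C
        = replicateCol Unit (fun _ : Fin n => (Polynomial.X : Polynomial ℝ))
          * replicateRow Unit (fun _ : Fin n => Polynomial.C c) := by
      ext1 i j
      simp [constMatrix, mul_apply]
    rw [e, h]
    simp [dotProduct]
    ring
  rw [← hJ, ← det_mul]
  congr 1
  have h0 : M.map Polynomial.C * (constMatrix n c).map Polynomial.C = 0 := by
    ext1 i j
    simp only [mul_apply, map_apply, constMatrix, of_apply, Matrix.zero_apply]
    rw [← sum_mul, ← map_sum, hM]
    simp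
  have hadd : (M + constMatrix n c).map Polynomial.C
      = M.map Polynomial.C + (constMatrix n c).map Polynomial.C := by
    ext1 i j
    simp
  simp only [add_mul, mul_add, one_mul, mul_one, smul_mul_assoc, mul_smul_comm, h0, hadd,
    smul_add, smul_zero, add_zero]
  abel

/-- Adding a constant to all entries of a matrix with zero row sums multiplies the polynomial
`det (1 + X M)` by a linear factor. -/
theorem secularCoeff_add_constMatrix {M : Matrix (Fin n) (Fin n) ℝ}
    (hM : ∀ i, ∑ j, M i j = 0) (c : ℝ) (k : ℕ) :
    secularCoeff (M + constMatrix n c) (k + 1)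
      = secularCoeff M (k + 1) + n * c * secularCoeff M k := by
  rw [secularCoeff_eq_coeff, det_one_add_smul_add_constMatrix hM, mul_add, mul_one,
    Polynomial.coeff_add, ← mul_assoc, Polynomial.coeff_mul_X, Polynomial.coeff_mul_C,
    secularCoeff_eq_coeff, secularCoeff_eq_coeff]
  ring

theorem mul_transpose_add_constMatrix {M : Matrix (Fin n) (Fin n) ℝ}
    (hM : ∀ i, ∑ j, M i j = 0) (c : ℝ) :
    (M + constMatrix n c) * (M + constMatrix n c)ᵀ = M * Mᵀ + constMatrix n (n * c ^ 2) := by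
  ext i j
  simp only [mul_apply, Matrix.add_apply, transpose_apply, constMatrix, of_apply]
  have : ∀ l, (M i l + c) * (M j l + c) = M i l * M j l + c * M i l + c * M j l + c ^ 2 :=
    fun l => by ring
  simp only [this, sum_add_distrib, ← mul_sum, hM]
  simp

theorem sum_mul_transpose_eq_zero {M : Matrix (Fin n) (Fin n) ℝ}
    (hM : ∀ j, ∑ i, M i j = 0) (i : Fin n) : ∑ j, (M * Mᵀ) i j = 0 := by
  simp only [mul_apply, transpose_apply]
  rw [sum_comm]
  simp [← mul_sum, hM]

@[simp]
theorem secularCoeff_zero (M : Matrix (Fin n) (Fin n) ℝ) : secularCoeff M 0 = 1 := by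
  simp [secularCoeff, principalMinor]

theorem principalMinor_mul_transpose_nonneg (M : Matrix (Fin n) (Fin n) ℝ)
    (I : Finset (Fin n)) : 0 ≤ principalMinor (M * Mᵀ) I := by
  have h := factorial_mul_det_mul_transpose (M.submatrix (fun i : I => (i : Fin n)) id)
  have h2 : principalMinor (M * Mᵀ) I = ((M.submatrix (fun i : I => (i : Fin n)) id)
      * (M.submatrix (fun i : I => (i : Fin n)) id)ᵀ).det := rfl
  rw [h2]
  refine nonneg_of_mul_nonneg_right (a := ((Fintype.card I).factorial : ℝ)) ?_ (by positivity)
  rw [h]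
  positivity

end PermSum

/-! ### Minors of matrices with exchangeable rows and columns -/

namespace PermSum

open Matrix Finset

open scoped BigOperators

variable {n : ℕ}

/-- The law of the random matrix `X`, where `s` is uniformly distributed in the finite type `S`, is
invariant under permutations of the rows and under permutations of the columns. -/
structure Exchangeable {S : Type*} [Fintype S] (X : S → Matrix (Fin n) (Fin n) ℝ) : Prop where
  row : ∀ (ρ : Equiv.Perm (Fin n)) (F : Matrix (Fin n) (Fin n) ℝ → ℝ),
    𝔼 s, F ((X s).submatrix ρ id) = 𝔼 s, F (X s)
  col : ∀ (ρ : Equiv.Perm (Fin n)) (F : Matrix (Fin n) (Fin n) ℝ → ℝ),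
    𝔼 s, F ((X s).submatrix id ρ) = 𝔼 s, F (X s)

theorem Exchangeable.transpose {S : Type*} [Fintype S] {X : S → Matrix (Fin n) (Fin n) ℝ}
    (hX : Exchangeable X) : Exchangeable fun s => (X s)ᵀ where
  row ρ F := hX.col ρ fun M => F Mᵀ
  col ρ F := hX.row ρ fun M => F Mᵀ

theorem Exchangeable.add_const {S : Type*} [Fintype S] {X : S → Matrix (Fin n) (Fin n) ℝ}
    (hX : Exchangeable X) (c : ℝ) : Exchangeable fun s => X s + constMatrix n c where
  row ρ F := hX.row ρ fun M => F (M + constMatrix n c)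
  col ρ F := hX.col ρ fun M => F (M + constMatrix n c)

/-- The minor of `M` with rows `x` and columns `z`, listed in this order and possibly repeated. -/
noncomputable def tupleMinor {ι : Type*} [Fintype ι] [DecidableEq ι]
    (M : Matrix (Fin n) (Fin n) ℝ) (x z : ι → Fin n) : ℝ :=
  (M.submatrix x z).det

section tupleMinor

variable {ι : Type*} [Fintype ι] [DecidableEq ι] (M : Matrix (Fin n) (Fin n) ℝ) (x z : ι → Fin n)

theorem tupleMinor_transpose : tupleMinor Mᵀ x z = tupleMinor M z x := by
  rw [tupleMinor, tupleMinor, ← det_transpose]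
  rfl

theorem tupleMinor_submatrix (ρ τ : Fin n → Fin n) :
    tupleMinor (M.submatrix ρ τ) x z = tupleMinor M (ρ ∘ x) (τ ∘ z) := rfl

theorem tupleMinor_comp_equiv {κ : Type*} [Fintype κ] [DecidableEq κ] (e : κ ≃ ι) :
    tupleMinor M (x ∘ e) (z ∘ e) = tupleMinor M x z :=
  det_submatrix_equiv_self e (M.submatrix x z)

theorem tupleMinor_eq_zero_of_row_eq {i j : ι} (hij : i ≠ j) (h : x i = x j) :
    tupleMinor M x z = 0 :=
  det_zero_of_row_eq hij (by ext b; simp [h])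

theorem tupleMinor_eq_zero_of_col_not_injective (h : ¬ Function.Injective z) :
    tupleMinor M x z = 0 := by
  simp only [Function.Injective, not_forall] at h
  obtain ⟨i, j, hz, hij⟩ := h
  rw [← tupleMinor_transpose]
  exact tupleMinor_eq_zero_of_row_eq _ _ _ hij hz

theorem tupleMinor_comp_perm_left (τ : Equiv.Perm ι) :
    tupleMinor M (x ∘ τ) z = (Equiv.Perm.sign τ : ℤ) * tupleMinor M x z :=
  det_permute τ (M.submatrix x z)

theorem sum_tupleMinor_update (T : Finset (Fin n)) (i : ι) :
    ∑ j ∈ T, tupleMinor M (Function.update x i j) z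
      = ((M.submatrix x z).updateRow i fun b => ∑ j ∈ T, M j (z b)).det := by
  have h := (detRowAlternating (R := ℝ) (n := ι)).map_update_sum T i
    (fun j b => M j (z b)) (M.submatrix x z)
  have e : (fun b => ∑ j ∈ T, M j (z b)) = ∑ j ∈ T, fun b => M j (z b) := by
    ext b
    simp
  rw [e]
  refine Eq.trans ?_ h.symm
  refine sum_congr rfl fun j _ => ?_
  show det _ = det _
  congr 1
  ext a b
  by_cases ha : a = i
  · subst ha
    rw [submatrix_apply, Function.update_self]
    exact (congrFun (Function.update_self (β := fun _ => ι → ℝ) a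
      (fun b => M j (z b)) (M.submatrix x z)) b).symm
  · rw [submatrix_apply, Function.update_of_ne ha]
    exact (congrFun (Function.update_of_ne (β := fun _ => ι → ℝ) ha
      (fun b => M j (z b)) (M.submatrix x z)) b).symm

variable {M} in
theorem sum_univ_tupleMinor_update (hM : ∀ j, ∑ i, M i j = 0) (i : ι) :
    ∑ j, tupleMinor M (Function.update x i j) z = 0 := by
  rw [sum_tupleMinor_update]
  refine det_eq_zero_of_row_eq_zero i fun b => ?_
  simp [hM]

end tupleMinor

theorem principalMinor_eq_tupleMinor {ι : Type*} [Fintype ι] [DecidableEq ι]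
    (M : Matrix (Fin n) (Fin n) ℝ) {x : ι → Fin n} (hx : Function.Injective x)
    {I : Finset (Fin n)} (hI : ∀ j, j ∈ I ↔ ∃ i, x i = j) :
    principalMinor M I = tupleMinor M x x := by
  let e : ι ≃ I := Equiv.ofBijective (fun i => ⟨x i, (hI _).2 ⟨i, rfl⟩⟩)
    ⟨fun a b h => hx (by simpa using h), fun j => by
      obtain ⟨i, hi⟩ := (hI j).1 j.2
      exact ⟨i, Subtype.ext hi⟩⟩
  exact (tupleMinor_comp_equiv M (fun i : I => (i : Fin n)) (fun i : I => (i : Fin n)) e).symm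

theorem principalMinor_submatrix_swap {I : Finset (Fin n)} (M : Matrix (Fin n) (Fin n) ℝ)
    {i j : Fin n} (hi : i ∉ I) (hj : j ∉ I) :
    principalMinor (M.submatrix (Equiv.swap i j) id) I = principalMinor M I := by
  unfold principalMinor
  congr 1
  ext a b
  simp only [submatrix_apply, id]
  rw [Equiv.swap_apply_of_ne_of_ne (by rintro rfl; exact hi a.2) (by rintro rfl; exact hj a.2)]

namespace Exchangeable

variable {S : Type*} [Fintype S] {X : S → Matrix (Fin n) (Fin n) ℝ}

/-- Swapping two rows that meet `I` but not `J` changes the sign of the product of the minors. -/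
theorem expect_principalMinor_mul_eq_zero (hX : Exchangeable X) {I J : Finset (Fin n)}
    (h : 1 < #(I \ J)) : 𝔼 s, principalMinor (X s) I * principalMinor (X s) J = 0 := by
  obtain ⟨i, hi, j, hj, hij⟩ := one_lt_card.1 h
  rw [Finset.mem_sdiff] at hi hj
  have h1 := hX.row (Equiv.swap i j) fun M => principalMinor M I * principalMinor M J
  have h2 (M : Matrix (Fin n) (Fin n) ℝ) :
      principalMinor (M.submatrix (Equiv.swap i j) id) I = - principalMinor M I := by
    have h3 := tupleMinor_comp_perm_left M (fun i : I => (i : Fin n)) (fun i : I => (i : Fin n))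
      (Equiv.swap ⟨i, hi.1⟩ ⟨j, hj.1⟩)
    rw [Equiv.Perm.sign_swap (by simpa using hij)] at h3
    have h4 : (fun i : I => (i : Fin n)) ∘ (Equiv.swap ⟨i, hi.1⟩ ⟨j, hj.1⟩)
        = (Equiv.swap i j) ∘ (fun i : I => (i : Fin n)) := by
      ext a
      simp only [Function.comp, Equiv.swap_apply_def, Subtype.ext_iff]
      split_ifs <;> rfl
    rw [h4] at h3
    refine Eq.trans h3 ?_
    push_cast
    rw [neg_one_mul]
    rfl
  simp only [h2, principalMinor_submatrix_swap _ hi.2 hj.2, neg_mul, expect_neg_distrib] at h1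
  linarith

/-- A row index may be averaged over any set `T` of indices whose transpositions do not affect
anything else. -/
theorem card_mul_expect (hX : Exchangeable X) {ι : Type*} [Fintype ι] [DecidableEq ι]
    {x : ι → Fin n} {i : ι} {T : Finset (Fin n)} {j₀ : Fin n} (hj₀ : j₀ ∈ T)
    (hx : ∀ a, a ≠ i → x a ∉ T) {G : Matrix (Fin n) (Fin n) ℝ → ℝ}
    (hG : ∀ j ∈ T, ∀ M, G (M.submatrix (Equiv.swap j₀ j) id) = G M) (z : ι → Fin n) :
    (#T : ℝ) * 𝔼 s, G (X s) * tupleMinor (X s) (Function.update x i j₀) z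
      = 𝔼 s, G (X s) * ∑ j ∈ T, tupleMinor (X s) (Function.update x i j) z := by
  simp_rw [mul_sum]
  rw [expect_sum_comm, ← nsmul_eq_mul]
  refine (sum_eq_card_nsmul fun j hj => ?_).symm
  rw [← hX.row (Equiv.swap j₀ j) fun M => G M * tupleMinor M (Function.update x i j) z]
  refine expect_congr rfl fun s _ => ?_
  rw [hG j hj, tupleMinor_submatrix]
  congr 2
  ext1 a
  by_cases ha : a = i
  · subst ha; simp
  · have := hx a ha
    simp only [Function.comp, Function.update_of_ne ha]
    rw [Equiv.swap_apply_of_ne_of_ne (by rintro rfl; exact this hj₀) (by rintro rfl; exact this hj)]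

/-- The second moments of all minors of a given size agree, so that of a principal minor is the
average provided by the Cauchy–Binet formula. -/
theorem choose_mul_expect_principalMinor_sq (hX : Exchangeable X) (I : Finset (Fin n)) :
    (n.choose #I : ℝ) * 𝔼 s, principalMinor (X s) I ^ 2
      = 𝔼 s, principalMinor (X s * (X s)ᵀ) I := by
  have hfac : ((#I).factorial : ℝ) ≠ 0 := by positivity
  refine mul_left_cancel₀ hfac ?_
  let x : I → Fin n := fun i => i
  have h1 (s : S) : ((#I).factorial : ℝ) * principalMinor (X s * (X s)ᵀ) I
      = ∑ z : I → Fin n, tupleMinor (X s) x z ^ 2 := by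
    have h := factorial_mul_det_mul_transpose ((X s).submatrix x id)
    rw [Fintype.card_coe] at h
    exact h
  have h2 (z : I → Fin n) : 𝔼 s, tupleMinor (X s) x z ^ 2
      = if Function.Injective z then 𝔼 s, principalMinor (X s) I ^ 2 else 0 := by
    split_ifs with hz
    · obtain ⟨σ, hσ⟩ := Equiv.Perm.exists_extending_pair x z Subtype.val_injective hz
      rw [← hX.col σ fun M => principalMinor M I ^ 2]
      refine expect_congr rfl fun s _ => ?_
      show _ = (tupleMinor _ x (σ ∘ x)) ^ 2
      congr 2
      ext1 i
      simp [hσ]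
    · exact expect_eq_zero fun s _ => by
        rw [tupleMinor_eq_zero_of_col_not_injective _ _ _ hz]; simp
  rw [mul_expect univ (fun s => principalMinor (X s * (X s)ᵀ) I), expect_congr rfl fun s _ => h1 s,
    expect_sum_comm, sum_congr rfl fun z _ => h2 z,
    ← sum_filter, sum_const, nsmul_eq_mul, ← mul_assoc]
  congr 1
  rw [← Nat.cast_mul, ← Nat.descFactorial_eq_factorial_mul_choose]
  have := Fintype.card_embedding_eq (α := I) (β := Fin n)
  rw [Fintype.card_coe, Fintype.card_fin] at this
  rw [← this, ← Fintype.card_subtype]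
  exact_mod_cast (Fintype.card_congr (Equiv.subtypeInjectiveEquivEmbedding I (Fin n))).symm

end Exchangeable

end PermSum

/-! ### Second moments of the secular coefficients of exchangeable matrices -/

namespace PermSum

open Matrix Finset

open scoped BigOperators

variable {n : ℕ} {S : Type*} [Fintype S] {X : S → Matrix (Fin n) (Fin n) ℝ}

/-- The sets that share all but one element with `I` and have the same size as `I` arise from `I`
by exchanging an element of `I` for one outside. -/
theorem filter_card_inter_eq_image {I : Finset (Fin n)} {k : ℕ} (hI : #I = k) (hk : 1 ≤ k) :
    (powersetCard k (univ : Finset (Fin n))).filter (fun J => #(I ∩ J) = k - 1)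
      = (I ×ˢ Iᶜ).image fun p => insert p.2 (I.erase p.1) := by
  ext J
  simp only [Finset.mem_filter, mem_powersetCard, subset_univ, true_and, Finset.mem_image,
    mem_product, Prod.exists, mem_compl]
  constructor
  · rintro ⟨hJ, hIJ⟩
    have h1 := card_sdiff_add_card_inter I J
    have h2 := card_sdiff_add_card_inter J I
    rw [Finset.inter_comm] at h2
    obtain ⟨i, hi⟩ := card_eq_one.1 (show #(I \ J) = 1 by omega)
    obtain ⟨j, hj⟩ := card_eq_one.1 (show #(J \ I) = 1 by omega)
    simp only [Finset.ext_iff, Finset.mem_sdiff, Finset.mem_singleton] at hi hj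
    refine ⟨i, j, ⟨((hi i).2 rfl).1, ((hj j).2 rfl).2⟩, ?_⟩
    ext a
    have := hi a
    have := hj a
    simp only [Finset.mem_insert, mem_erase]
    tauto
  · rintro ⟨i, j, ⟨hi, hj⟩, rfl⟩
    have hj' : j ∉ I.erase i := fun h => hj (mem_of_mem_erase h)
    refine ⟨by rw [card_insert_of_notMem hj', card_erase_of_mem hi]; omega, ?_⟩
    rw [inter_insert_of_notMem hj, inter_eq_right.2 (erase_subset _ _), card_erase_of_mem hi, hI]

theorem card_filter_card_inter {I : Finset (Fin n)} {k : ℕ} (hI : #I = k) (hk : 1 ≤ k) :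
    #((powersetCard k (univ : Finset (Fin n))).filter (fun J => #(I ∩ J) = k - 1))
      = k * (n - k) := by
  rw [filter_card_inter_eq_image hI hk, card_image_of_injOn, card_product, card_compl, hI,
    Fintype.card_fin]
  rintro ⟨i, j⟩ hij ⟨i', j'⟩ hij' h
  simp only [coe_product, Set.mem_prod, mem_coe, mem_compl] at hij hij'
  simp only [Finset.ext_iff, Finset.mem_insert, mem_erase] at h
  have h1 := h i
  have h2 := h j
  have hne : i ≠ j := fun e => hij.2 (e ▸ hij.1)
  have hne' : i ≠ j' := fun e => hij'.2 (e ▸ hij.1)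
  have hne'' : j ≠ i' := fun e => hij.2 (e ▸ hij'.1)
  simp only [Prod.mk.injEq]
  tauto

/-- The only minor of full size is the determinant, and the constant vector lies in the kernel. -/
theorem principalMinor_eq_zero_of_card_eq {M : Matrix (Fin n) (Fin n) ℝ} (hn : 0 < n)
    (hM : ∀ i, ∑ j, M i j = 0) {I : Finset (Fin n)} (hI : #I = n) : principalMinor M I = 0 := by
  have : I = univ := by
    rw [← card_eq_iff_eq_univ, Fintype.card_fin, hI]
  subst this
  rw [principalMinor_eq_tupleMinor M (x := id) Function.injective_id (by simp)]
  refine exists_mulVec_eq_zero_iff.1 ⟨fun _ => 1, ?_, ?_⟩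
  · intro h
    have := congrFun h ⟨0, hn⟩
    simp at this
  · ext i
    simpa [mulVec, dotProduct] using hM i

namespace Exchangeable

/-- Only pairs of sets sharing all but at most one element contribute to the second moment of a
secular coefficient. -/
theorem expect_secularCoeff_sq (hX : Exchangeable X) {k : ℕ} (hk : 1 ≤ k) :
    𝔼 s, secularCoeff (X s) k ^ 2
      = ∑ I ∈ powersetCard k (univ : Finset (Fin n)), 𝔼 s, principalMinor (X s) I ^ 2
        + ∑ I ∈ powersetCard k (univ : Finset (Fin n)),
            ∑ J ∈ (powersetCard k (univ : Finset (Fin n))).filter (fun J => #(I ∩ J) = k - 1),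
              𝔼 s, principalMinor (X s) I * principalMinor (X s) J := by
  simp only [secularCoeff, sq, sum_mul_sum]
  rw [expect_sum_comm, ← sum_add_distrib]
  refine sum_congr rfl fun I hI => ?_
  rw [expect_sum_comm]
  have hIc := (mem_powersetCard.1 hI).2
  rw [← sum_filter_add_sum_filter_not _ (fun J => #(I ∩ J) = k - 1), add_comm]
  congr 1
  refine sum_eq_single_of_mem I ?_ fun J hJ hne => ?_
  · rw [Finset.mem_filter]
    refine ⟨hI, ?_⟩
    rw [Finset.inter_self]
    omega
  · rw [Finset.mem_filter, mem_powersetCard] at hJ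
    refine hX.expect_principalMinor_mul_eq_zero ?_
    have h1 := card_sdiff_add_card_inter I J
    have h0 : #(I \ J) ≠ 0 := fun h => by
      rw [card_eq_zero, sdiff_eq_empty_iff_subset] at h
      exact hne (eq_of_subset_of_card_le h (by omega)).symm
    omega

/-- With zero column sums, averaging the additional row index gives zero. -/
theorem expect_principalMinor_mul_eq_zero_of_card (hX : Exchangeable X)
    (hcol : ∀ s j, ∑ i, X s i j = 0) {I J : Finset (Fin n)} (h : #J < #I) :
    𝔼 s, principalMinor (X s) I * principalMinor (X s) J = 0 := by
  rcases lt_or_ge 1 #(I \ J) with h1 | h1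
  · exact hX.expect_principalMinor_mul_eq_zero h1
  have h2 := card_sdiff_add_card_inter I J
  have h3 := card_le_card (inter_subset_right (s₁ := I) (s₂ := J))
  obtain ⟨i, hi⟩ := card_eq_one.1 (show #(I \ J) = 1 by omega)
  have hJI : J ⊆ I := by
    have : I ∩ J = J := eq_of_subset_of_card_le inter_subset_right (by omega)
    exact inter_eq_right.1 this
  simp only [Finset.ext_iff, Finset.mem_sdiff, Finset.mem_singleton] at hi
  obtain ⟨hiI, hiJ⟩ := (hi i).2 rfl
  let x : I → Fin n := fun a => a
  have key := hX.card_mul_expect (x := x) (i := ⟨i, hiI⟩) (T := Jᶜ) (j₀ := i) (by simpa using hiJ)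
    (fun a ha => by
      have := (hi a).1
      rw [mem_compl, not_not]
      by_contra hc
      exact ha (Subtype.ext (this ⟨a.2, hc⟩)))
    (G := fun M => principalMinor M J)
    (fun j hj M => principalMinor_submatrix_swap M hiJ (by simpa using hj)) x
  have hz (s : S) : ∑ j ∈ Jᶜ, tupleMinor (X s) (Function.update x ⟨i, hiI⟩ j) x = 0 := by
    rw [← sum_univ_tupleMinor_update x x (hcol s) ⟨i, hiI⟩]
    refine sum_subset (subset_univ _) fun j _ hj => ?_
    rw [mem_compl, not_not] at hj
    refine tupleMinor_eq_zero_of_row_eq _ _ _ (i := ⟨i, hiI⟩) (j := ⟨j, hJI hj⟩) ?_ ?_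
    · rintro e
      rw [Subtype.mk.injEq] at e
      exact hiJ (e ▸ hj)
    · rw [Function.update_self, Function.update_of_ne]
      rintro e
      rw [Subtype.mk.injEq] at e
      exact hiJ (e ▸ hj)
  simp only [hz, mul_zero, expect_const_zero] at key
  have hx : Function.update x ⟨i, hiI⟩ i = x := Function.update_eq_self_iff.2 rfl
  rw [hx] at key
  have hc : (#Jᶜ : ℝ) ≠ 0 := by
    have : 0 < #Jᶜ := card_pos.2 ⟨i, by simpa using hiJ⟩
    positivity
  have := (mul_eq_zero.1 key).resolve_left hc
  rw [← this]
  exact expect_congr rfl fun s _ => mul_comm _ _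

/-- Consecutive secular coefficients are uncorrelated if the column sums vanish. -/
theorem expect_secularCoeff_succ_mul (hX : Exchangeable X)
    (hcol : ∀ s j, ∑ i, X s i j = 0) (k : ℕ) :
    𝔼 s, secularCoeff (X s) (k + 1) * secularCoeff (X s) k = 0 := by
  simp only [secularCoeff, sum_mul_sum]
  rw [expect_sum_comm]
  refine sum_eq_zero fun I hI => ?_
  rw [expect_sum_comm]
  refine sum_eq_zero fun J hJ => ?_
  refine hX.expect_principalMinor_mul_eq_zero_of_card hcol ?_
  rw [(mem_powersetCard.1 hI).2, (mem_powersetCard.1 hJ).2]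
  omega

/-- With zero column sums, averaging a row index outside the range of `x` produces the minor with
the rows `x`. -/
theorem expect_mul_tupleMinor_update (hX : Exchangeable X)
    (hcol : ∀ s j, ∑ i, X s i j = 0) {I : Finset (Fin n)} {i : I} {j : Fin n} (hj : j ∉ I)
    (u w : I → Fin n) :
    ((n : ℝ) - #I) * 𝔼 s, tupleMinor (X s) (fun a : I => (a : Fin n)) u
        * tupleMinor (X s) (Function.update (fun a : I => (a : Fin n)) i j) w
      = - 𝔼 s, tupleMinor (X s) (fun a : I => (a : Fin n)) u
          * tupleMinor (X s) (fun a : I => (a : Fin n)) w := by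
  set x : I → Fin n := fun a => (a : Fin n) with hx
  have key := hX.card_mul_expect (x := x) (i := i) (T := Iᶜ) (j₀ := j) (by simpa using hj)
    (fun a ha => by simp [hx]) (G := fun M => tupleMinor M x u)
    (fun j' hj' M => by
      rw [tupleMinor_submatrix]
      congr 1
      ext1 a
      rw [mem_compl] at hj'
      exact Equiv.swap_apply_of_ne_of_ne (by rintro rfl; exact hj a.2)
        (by rintro rfl; exact hj' a.2)) w
  have hz (s : S) : ∑ j ∈ Iᶜ, tupleMinor (X s) (Function.update x i j) w
      = - tupleMinor (X s) x w := by
    have h1 := sum_univ_tupleMinor_update x w (hcol s) i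
    rw [← sum_compl_add_sum I] at h1
    have h2 : ∑ j ∈ I, tupleMinor (X s) (Function.update x i j) w = tupleMinor (X s) x w := by
      rw [sum_eq_single_of_mem (i : Fin n) i.2]
      · rw [show Function.update x i (i : Fin n) = x from Function.update_eq_self_iff.2 rfl]
      · intro j' hj' hne
        refine tupleMinor_eq_zero_of_row_eq _ _ _ (i := i) (j := ⟨j', hj'⟩) ?_ ?_
        · rintro rfl; exact hne rfl
        · rw [Function.update_self, Function.update_of_ne]
          rintro rfl; exact hne rfl
    linarith
  simp only [hz, mul_neg, expect_neg_distrib] at key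
  rw [card_compl, Fintype.card_fin, Nat.cast_sub (by simpa using card_le_univ I)] at key
  exact key

/-- The correlation of two minors of size `k` whose index sets differ by one exchange: passing from
one set to the other costs a factor `-1 / (n - k)` for the rows and another for the columns. -/
theorem expect_principalMinor_mul_exchange (hX : Exchangeable X)
    (hrow : ∀ s i, ∑ j, X s i j = 0) (hcol : ∀ s j, ∑ i, X s i j = 0)
    {I : Finset (Fin n)} {i j : Fin n} (hi : i ∈ I) (hj : j ∉ I) :
    ((n : ℝ) - #I) ^ 2 *
        𝔼 s, principalMinor (X s) I * principalMinor (X s) (insert j (I.erase i))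
      = 𝔼 s, principalMinor (X s) I ^ 2 := by
  set x : I → Fin n := fun a => (a : Fin n) with hx
  set y : I → Fin n := Function.update x ⟨i, hi⟩ j with hy
  have hyinj : Function.Injective y := by
    intro a b hab
    simp only [hy, Function.update_apply, hx] at hab
    split_ifs at hab with h1 h2 h2
    · rw [h1, h2]
    · exact absurd (hab ▸ b.2) hj
    · exact absurd (hab ▸ a.2) hj
    · exact Subtype.ext hab
  have hJ (M : Matrix (Fin n) (Fin n) ℝ) :
      principalMinor M (insert j (I.erase i)) = tupleMinor M y y := by
    refine principalMinor_eq_tupleMinor M hyinj fun a => ?_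
    rw [Finset.mem_insert, mem_erase]
    constructor
    · rintro (rfl | ⟨hne, ha⟩)
      · exact ⟨⟨i, hi⟩, Function.update_self _ _ _⟩
      · exact ⟨⟨a, ha⟩, Function.update_of_ne (by simpa using hne) _ _⟩
    · rintro ⟨b, rfl⟩
      by_cases hb : b = ⟨i, hi⟩
      · left; rw [hb]; exact Function.update_self _ _ _
      · right
        have : y b = b := Function.update_of_ne hb _ _
        rw [this]
        exact ⟨fun e => hb (Subtype.ext e), b.2⟩
  have h1 := hX.expect_mul_tupleMinor_update hcol (i := ⟨i, hi⟩) hj x y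
  have h2 := hX.transpose.expect_mul_tupleMinor_update (fun s => hrow s) (i := ⟨i, hi⟩) hj x x
  simp only [tupleMinor_transpose] at h2
  simp only [hJ, sq]
  rw [mul_assoc]
  refine Eq.trans (congrArg _ h1) ?_
  rw [mul_neg]
  refine Eq.trans (congrArg _ h2) ?_
  rw [neg_neg]
  rfl

/-- The trace of the `k`-th exterior power has mean square the mean square Hilbert–Schmidt norm
divided by the dimension, for a matrix acting on the hyperplane of vectors with zero sum. -/
theorem sub_mul_expect_secularCoeff_sq (hX : Exchangeable X)
    (hrow : ∀ s i, ∑ j, X s i j = 0) (hcol : ∀ s j, ∑ i, X s i j = 0) {k : ℕ}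
    (hk : k ≤ n) :
    ((n : ℝ) - k) * 𝔼 s, secularCoeff (X s) k ^ 2
      = n * ∑ I ∈ powersetCard k (univ : Finset (Fin n)), 𝔼 s, principalMinor (X s) I ^ 2 := by
  rcases Nat.eq_zero_or_pos k with rfl | hk1
  · simp [principalMinor]
  rcases hk.eq_or_lt with rfl | hkn
  · rw [sub_self, zero_mul, eq_comm]
    refine mul_eq_zero_of_right _ (sum_eq_zero fun I hI => expect_eq_zero fun s _ => ?_)
    rw [principalMinor_eq_zero_of_card_eq hk1 (hrow s) (mem_powersetCard.1 hI).2]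
    simp
  have hpos : (0 : ℝ) < (n : ℝ) - k := by
    rw [sub_pos]; exact_mod_cast hkn
  rw [hX.expect_secularCoeff_sq hk1, ← sum_add_distrib, mul_sum, mul_sum]
  refine sum_congr rfl fun I hI => ?_
  have hIc := (mem_powersetCard.1 hI).2
  set α := 𝔼 s, principalMinor (X s) I ^ 2 with hα
  have h1 : ∀ J ∈ (powersetCard k (univ : Finset (Fin n))).filter (fun J => #(I ∩ J) = k - 1),
      𝔼 s, principalMinor (X s) I * principalMinor (X s) J = α / ((n : ℝ) - k) ^ 2 := by
    intro J hJ
    rw [filter_card_inter_eq_image hIc hk1, Finset.mem_image] at hJ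
    obtain ⟨p, hp, rfl⟩ := hJ
    rw [mem_product, mem_compl] at hp
    have := hX.expect_principalMinor_mul_exchange hrow hcol hp.1 hp.2
    rw [hIc] at this
    rw [eq_div_iff (by positivity), mul_comm]
    exact this
  rw [sum_congr rfl h1, sum_const, card_filter_card_inter hIc hk1, nsmul_eq_mul, Nat.cast_mul,
    Nat.cast_sub hk]
  field_simp
  ring

end Exchangeable

end PermSum

/-! ### Projection onto the orthogonal complement of a row space -/

namespace PermSum

open Matrix Finset

open scoped BigOperators

section rowComplProj

variable {ι m : Type*} [Fintype ι] [DecidableEq ι] [Fintype m] [DecidableEq m]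

/-- The matrix of the orthogonal projection onto the orthogonal complement of the row space of `R`,
provided that the rows are linearly independent. For dependent rows the inverse is zero by
convention and the value is `1`; the Gram determinant `det (R Rᵀ)`, by which it is then always
multiplied, vanishes in that case. -/
noncomputable def rowComplProj (R : Matrix ι m ℝ) : Matrix m m ℝ :=
  1 - Rᵀ * (R * Rᵀ)⁻¹ * R

variable {R : Matrix ι m ℝ}

theorem mul_rowComplProj (h : IsUnit (R * Rᵀ).det) : R * rowComplProj R = 0 := by
  rw [rowComplProj, Matrix.mul_sub, Matrix.mul_one, ← Matrix.mul_assoc,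
    ← Matrix.mul_assoc, mul_nonsing_inv _ h, Matrix.one_mul, sub_self]

theorem rowComplProj_transpose : (rowComplProj R)ᵀ = rowComplProj R := by
  simp only [rowComplProj, transpose_sub, transpose_mul, transpose_nonsing_inv, transpose_transpose,
    transpose_one, Matrix.mul_assoc]

theorem rowComplProj_mul_self (h : IsUnit (R * Rᵀ).det) :
    rowComplProj R * rowComplProj R = rowComplProj R := by
  nth_rewrite 1 [rowComplProj]
  rw [Matrix.sub_mul, Matrix.one_mul, Matrix.mul_assoc _ R, mul_rowComplProj h, Matrix.mul_zero,
    sub_zero]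

theorem dotProduct_rowComplProj_nonneg (h : IsUnit (R * Rᵀ).det) (v : m → ℝ) :
    0 ≤ v ⬝ᵥ rowComplProj R *ᵥ v := by
  rw [← rowComplProj_mul_self h, ← mulVec_mulVec, dotProduct_mulVec]
  nth_rewrite 1 [← rowComplProj_transpose]
  rw [vecMul_transpose]
  exact sum_nonneg fun i _ => mul_self_nonneg _

theorem trace_rowComplProj (h : IsUnit (R * Rᵀ).det) :
    (rowComplProj R).trace = Fintype.card m - Fintype.card ι := by
  rw [rowComplProj, trace_sub, trace_one, trace_mul_comm, ← Matrix.mul_assoc, mul_nonsing_inv _ h,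
    trace_one]

theorem rowComplProj_mulVec_of_mulVec_eq_zero {v : m → ℝ} (hv : R *ᵥ v = 0) :
    rowComplProj R *ᵥ v = v := by
  rw [rowComplProj, sub_mulVec, one_mulVec, ← mulVec_mulVec, hv, mulVec_zero, sub_zero]

theorem rowComplProj_mulVec_row (h : IsUnit (R * Rᵀ).det) (i : ι) :
    rowComplProj R *ᵥ R.row i = 0 := by
  have h1 := mul_rowComplProj h
  rw [← rowComplProj_transpose, mulVec_transpose]
  exact congrFun h1 i

/-- Appending the row `c` to `R` multiplies the Gram determinant by the squared distance of `c` to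
the row space of `R`. -/
theorem det_fromBlocks_gram (R : Matrix ι m ℝ) (c : m → ℝ) :
    (fromBlocks (R * Rᵀ) (R * replicateCol Unit c) (replicateRow Unit c * Rᵀ)
        (replicateRow Unit c * replicateCol Unit c)).det
      = (R * Rᵀ).det * (c ⬝ᵥ rowComplProj R *ᵥ c) := by
  by_cases h : IsUnit (R * Rᵀ).det
  · have : Invertible (R * Rᵀ) := invertibleOfIsUnitDet _ h
    rw [det_fromBlocks₁₁, invOf_eq_nonsing_inv]
    congr 1
    have e : replicateRow Unit c * replicateCol Unit c
        - replicateRow Unit c * Rᵀ * (R * Rᵀ)⁻¹ * (R * replicateCol Unit c)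
        = replicateRow Unit c * (rowComplProj R * replicateCol Unit c) := by
      simp only [rowComplProj, Matrix.sub_mul, Matrix.mul_sub, Matrix.one_mul, Matrix.mul_assoc]
    rw [e, det_unique]
    rfl
  · -- A vector in the left kernel of `R` extends by zero to one in the kernel of the larger matrix.
    have h0 : (R * Rᵀ).det = 0 := by
      by_contra hne
      exact h (isUnit_iff_ne_zero.2 hne)
    rw [h0, zero_mul]
    obtain ⟨v, hv, hRv⟩ := exists_mulVec_eq_zero_iff.2 h0
    have hv0 : Rᵀ *ᵥ v = 0 := by
      rw [← dotProduct_self_eq_zero, dotProduct_mulVec, vecMul_transpose, mulVec_mulVec, hRv,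
        zero_dotProduct]
    refine exists_mulVec_eq_zero_iff.1 ⟨Sum.elim v 0, ?_, ?_⟩
    · intro hc
      exact hv (funext fun i => congrFun hc (Sum.inl i))
    · rw [fromBlocks_mulVec]
      simp only [Sum.elim_comp_inl, Sum.elim_comp_inr, mulVec_zero, add_zero, hRv,
        ← mulVec_mulVec, hv0]
      ext i
      cases i <;> rfl

end rowComplProj

variable {n d : ℕ}

theorem principalMinor_mul_transpose_insert (M : Matrix (Fin n) (Fin n) ℝ) {I : Finset (Fin n)}
    {a : Fin n} (ha : a ∉ I) :
    principalMinor (M * Mᵀ) (insert a I) = principalMinor (M * Mᵀ) I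
      * (M a ⬝ᵥ rowComplProj (M.submatrix (fun i : I => (i : Fin n)) id) *ᵥ M a) := by
  rw [principalMinor_eq_tupleMinor (ι := I ⊕ Unit) _
    (x := Sum.elim (fun i : I => (i : Fin n)) fun _ => a)]
  · refine Eq.trans ?_ (det_fromBlocks_gram (M.submatrix (fun i : I => (i : Fin n)) id) (M a))
    unfold tupleMinor
    congr 1
    ext (i | i) (j | j) <;> rfl
  · rintro (i | i) (j | j) h
    · exact congrArg _ (Subtype.ext h)
    · exact absurd (show (i : Fin n) = a from h) fun e => ha (e ▸ i.2)
    · exact absurd (show a = (j : Fin n) from h) fun e => ha (e ▸ j.2)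
    · rfl
  · intro j
    simp [eq_comm, or_comm]

/-! ### The sum of the projected permutation matrices -/

/-- The permutation matrix sum minus its mean. It is the restriction of the permutation matrix sum
to the hyperplane of vectors with zero sum, extended by zero. -/
noncomputable def centeredSum (σ : Fin d → Equiv.Perm (Fin n)) : Matrix (Fin n) (Fin n) ℝ :=
  permMatrixSum σ + constMatrix n (-(d / n))

/-- Row `i` of the permutation matrix of `τ` minus its mean. -/
noncomputable def centeredRow (τ : Equiv.Perm (Fin n)) (i : Fin n) : Fin n → ℝ :=
  fun j => (if τ i = j then 1 else 0) - 1 / n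

theorem permMatrixSum_apply (σ : Fin d → Equiv.Perm (Fin n)) (i j : Fin n) :
    permMatrixSum σ i j = ∑ q, if σ q i = j then 1 else 0 := by
  simp only [permMatrixSum, Matrix.sum_apply, Equiv.Perm.permMatrix, PEquiv.toMatrix_apply,
    Equiv.toPEquiv_apply, Option.mem_def, Option.some.injEq]

theorem centeredSum_row (σ : Fin d → Equiv.Perm (Fin n)) (i : Fin n) :
    centeredSum σ i = ∑ q, centeredRow (σ q) i := by
  ext j
  rw [Finset.sum_apply]
  simp only [centeredSum, Matrix.add_apply, permMatrixSum_apply, constMatrix, of_apply,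
    centeredRow, sum_sub_distrib, sum_const, card_univ, Fintype.card_fin, nsmul_eq_mul]
  ring

theorem permMatrixSum_eq (σ : Fin d → Equiv.Perm (Fin n)) :
    permMatrixSum σ = centeredSum σ + constMatrix n (d / n) := by
  ext i j
  simp [centeredSum, constMatrix]

theorem sum_centeredRow_apply (hn : 0 < n) (τ : Equiv.Perm (Fin n)) (i : Fin n) :
    ∑ j, centeredRow τ i j = 0 := by
  have : (n : ℝ) ≠ 0 := by positivity
  simp [centeredRow, sum_sub_distrib, this]

theorem sum_centeredRow (hn : 0 < n) (τ : Equiv.Perm (Fin n)) :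
    ∑ i, centeredRow τ i = 0 := by
  have : (n : ℝ) ≠ 0 := by positivity
  ext j
  rw [Finset.sum_apply]
  have h : ∀ i, (τ i = j) ↔ (i = τ.symm j) := fun i => by rw [Equiv.eq_symm_apply]
  simp [centeredRow, sum_sub_distrib, this, h]

theorem sum_centeredSum_row (hn : 0 < n) (σ : Fin d → Equiv.Perm (Fin n)) (i : Fin n) :
    ∑ j, centeredSum σ i j = 0 := by
  simp only [centeredSum_row, Finset.sum_apply]
  rw [sum_comm]
  exact sum_eq_zero fun q _ => sum_centeredRow_apply hn _ _

theorem sum_centeredSum_col (hn : 0 < n) (σ : Fin d → Equiv.Perm (Fin n)) (j : Fin n) :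
    ∑ i, centeredSum σ i j = 0 := by
  simp only [centeredSum_row, Finset.sum_apply]
  rw [sum_comm]
  refine sum_eq_zero fun q _ => ?_
  have := congrFun (sum_centeredRow hn (σ q)) j
  rwa [Finset.sum_apply] at this

/-- Multiplying all `d` permutations by a fixed one, on either side, preserves the uniform law. -/
theorem exchangeable_permMatrixSum :
    Exchangeable (permMatrixSum : (Fin d → Equiv.Perm (Fin n)) → Matrix (Fin n) (Fin n) ℝ) where
  row ρ F := by
    refine Fintype.expect_equiv (Equiv.mulRight fun _ => ρ) _ _ fun σ => ?_
    congr 1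
    ext i j
    simp only [submatrix_apply, id, permMatrixSum_apply, Equiv.coe_mulRight, Pi.mul_apply,
      Equiv.Perm.mul_apply]
    rfl
  col ρ F := by
    refine Fintype.expect_equiv (Equiv.mulLeft fun _ => ρ⁻¹) _ _ fun σ => ?_
    congr 1
    ext i j
    simp only [submatrix_apply, id, permMatrixSum_apply, Equiv.coe_mulLeft, Pi.mul_apply,
      Equiv.Perm.mul_apply, Equiv.Perm.inv_eq_iff_eq]

theorem exchangeable_centeredSum :
    Exchangeable (centeredSum : (Fin d → Equiv.Perm (Fin n)) → Matrix (Fin n) (Fin n) ℝ) :=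
  exchangeable_permMatrixSum.add_const _

end PermSum

/-! ### Expected Gram determinants of the centered sum -/

namespace PermSum

open Matrix Finset

open scoped BigOperators

variable {n d : ℕ}

/-- Composing the `p`-th permutation with the transposition of `a` and `j` preserves the uniform
law, so that one may average over `j`. -/
theorem card_mul_expect_swap (p : Fin d) (a : Fin n) (T : Finset (Fin n))
    (F : (Fin d → Equiv.Perm (Fin n)) → ℝ) :
    (#T : ℝ) * 𝔼 σ, F σ
      = 𝔼 σ : Fin d → Equiv.Perm (Fin n),
          ∑ j ∈ T, F (Function.update σ p (σ p * Equiv.swap a j)) := by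
  rw [expect_sum_comm, ← nsmul_eq_mul]
  refine (sum_eq_card_nsmul fun j _ => ?_).symm
  have hinv : Function.Involutive fun σ : Fin d → Equiv.Perm (Fin n) =>
      Function.update σ p (σ p * Equiv.swap a j) := by
    intro σ
    simp [mul_assoc]
  exact Fintype.expect_equiv hinv.toPerm _ _ fun σ => rfl

/-- The rows of the centered sum with indices in `I`. -/
noncomputable def rowsOn (σ : Fin d → Equiv.Perm (Fin n)) (I : Finset (Fin n)) :
    Matrix I (Fin n) ℝ :=
  (centeredSum σ).submatrix (fun i : I => (i : Fin n)) id

theorem rowsOn_update_swap (σ : Fin d → Equiv.Perm (Fin n)) {I : Finset (Fin n)} (p : Fin d)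
    {a j : Fin n} (ha : a ∉ I) (hj : j ∉ I) :
    rowsOn (Function.update σ p (σ p * Equiv.swap a j)) I = rowsOn σ I := by
  have h : ∀ i : I, (centeredSum (Function.update σ p (σ p * Equiv.swap a j))) i
      = centeredSum σ i := by
    intro i
    rw [centeredSum_row, centeredSum_row]
    refine sum_congr rfl fun q _ => ?_
    by_cases hq : q = p
    · subst hq
      rw [Function.update_self]
      ext l
      rw [centeredRow, centeredRow, Equiv.Perm.mul_apply, Equiv.swap_apply_of_ne_of_ne
        (by rintro rfl; exact ha i.2) (by rintro rfl; exact hj i.2)]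
    · rw [Function.update_of_ne hq]
  ext i l
  exact congrFun (h i) l

theorem centeredRow_mul_swap (τ : Equiv.Perm (Fin n)) (a j : Fin n) :
    centeredRow (τ * Equiv.swap a j) a = centeredRow τ j := by
  ext l
  rw [centeredRow, centeredRow, Equiv.Perm.mul_apply, Equiv.swap_apply_left]

/-- The contribution of two distinct permutations to the squared distance of row `a` to the span of
the rows in `I`: by independence each centered row may be replaced by its conditional mean. -/
theorem sq_mul_expect_cross (hn : 0 < n) {I : Finset (Fin n)} {a : Fin n} (ha : a ∉ I)
    {p q : Fin d} (hpq : p ≠ q) :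
    ((n : ℝ) - #I) ^ 2 * 𝔼 σ : Fin d → Equiv.Perm (Fin n), (rowsOn σ I * (rowsOn σ I)ᵀ).det *
        (centeredRow (σ p) a ⬝ᵥ rowComplProj (rowsOn σ I) *ᵥ centeredRow (σ q) a)
      = 𝔼 σ : Fin d → Equiv.Perm (Fin n), (rowsOn σ I * (rowsOn σ I)ᵀ).det *
        ((∑ i ∈ I, centeredRow (σ p) i) ⬝ᵥ rowComplProj (rowsOn σ I) *ᵥ
          (∑ i ∈ I, centeredRow (σ q) i)) := by
  have hc : (n : ℝ) - #I = #Iᶜ := by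
    rw [card_compl, Fintype.card_fin, Nat.cast_sub (by simpa using card_le_univ I)]
  have hT (τ : Equiv.Perm (Fin n)) :
      ∑ i ∈ Iᶜ, centeredRow τ i = - ∑ i ∈ I, centeredRow τ i := by
    rw [eq_neg_iff_add_eq_zero, sum_compl_add_sum, sum_centeredRow hn]
  rw [hc, sq, mul_assoc, card_mul_expect_swap p a, card_mul_expect_swap q a]
  refine expect_congr rfl fun σ _ => ?_
  have h (j : Fin n) (hj : j ∈ Iᶜ) (i : Fin n) (hi : i ∈ Iᶜ) : rowsOn (Function.update
      (Function.update σ q (σ q * Equiv.swap a j)) p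
      ((Function.update σ q (σ q * Equiv.swap a j)) p * Equiv.swap a i)) I = rowsOn σ I := by
    rw [mem_compl] at hi hj
    rw [rowsOn_update_swap _ _ ha hi, rowsOn_update_swap _ _ ha hj]
  rw [sum_congr rfl fun j hj => sum_congr rfl fun i hi => by
    rw [h j hj i hi, Function.update_self, Function.update_of_ne hpq, Function.update_of_ne hpq.symm,
      Function.update_self, centeredRow_mul_swap, centeredRow_mul_swap]]
  rw [sum_comm]
  simp only [← mul_sum, ← dotProduct_sum, ← sum_dotProduct, ← mulVec_sum]
  rw [hT, hT, mulVec_neg, neg_dotProduct_neg]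

/-- The contribution of a single permutation to the squared distance of row `a` to the span of the
rows in `I`: row `a` may be replaced by any row outside `I`. -/
theorem mul_expect_diag {I : Finset (Fin n)} {a : Fin n} (ha : a ∉ I) (p : Fin d) :
    ((n : ℝ) - #I) * 𝔼 σ : Fin d → Equiv.Perm (Fin n), (rowsOn σ I * (rowsOn σ I)ᵀ).det *
        (centeredRow (σ p) a ⬝ᵥ rowComplProj (rowsOn σ I) *ᵥ centeredRow (σ p) a)
      = 𝔼 σ : Fin d → Equiv.Perm (Fin n), (rowsOn σ I * (rowsOn σ I)ᵀ).det *
        ∑ j ∈ Iᶜ, centeredRow (σ p) j ⬝ᵥ rowComplProj (rowsOn σ I) *ᵥ centeredRow (σ p) j := by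
  have hc : (n : ℝ) - #I = #Iᶜ := by
    rw [card_compl, Fintype.card_fin, Nat.cast_sub (by simpa using card_le_univ I)]
  rw [hc, card_mul_expect_swap p a]
  refine expect_congr rfl fun σ _ => ?_
  rw [mul_sum]
  refine sum_congr rfl fun j hj => ?_
  rw [rowsOn_update_swap _ _ ha (by simpa using hj), Function.update_self, centeredRow_mul_swap]

/-- The left side is the trace of `Q` on the hyperplane orthogonal to the constant vector, which `Q`
fixes. -/
theorem sum_centeredRow_dotProduct (hn : 0 < n) (τ : Equiv.Perm (Fin n))
    {Q : Matrix (Fin n) (Fin n) ℝ} (hQ : Q *ᵥ (fun _ => 1) = fun _ => 1) (hQt : Qᵀ = Q) :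
    ∑ j, centeredRow τ j ⬝ᵥ Q *ᵥ centeredRow τ j = Q.trace - 1 := by
  have hn' : (n : ℝ) ≠ 0 := by positivity
  have e (j : Fin n) : centeredRow τ j = Pi.single (τ j) 1 - (1 / n : ℝ) • fun _ => (1 : ℝ) := by
    ext l
    simp [centeredRow, Pi.single_apply, eq_comm]
  have h1 (v : Fin n → ℝ) : (fun _ => (1 : ℝ)) ⬝ᵥ Q *ᵥ v = (fun _ => (1 : ℝ)) ⬝ᵥ v := by
    rw [dotProduct_mulVec, ← mulVec_transpose, hQt, hQ]
  have h2 (j : Fin n) : centeredRow τ j ⬝ᵥ Q *ᵥ centeredRow τ j = Q (τ j) (τ j) - 1 / n := by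
    have h3 : (fun _ : Fin n => (1 : ℝ)) ⬝ᵥ centeredRow τ j = 0 := by
      simpa [dotProduct] using sum_centeredRow_apply hn τ j
    have h4 : Q *ᵥ centeredRow τ j = Q *ᵥ Pi.single (τ j) 1 - (1 / n : ℝ) • fun _ => (1 : ℝ) := by
      rw [e, mulVec_sub, mulVec_smul, hQ]
    nth_rewrite 1 [e]
    rw [sub_dotProduct, smul_dotProduct, h1, h3, h4]
    simp
  rw [sum_congr rfl fun j _ => h2 j, sum_sub_distrib, Equiv.sum_comp τ fun j => Q j j]
  simp [trace, hn']

/-- Adding a row multiplies the expected Gram determinant by at most `d (m - 1) / m`, where `m` is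
the number of unused rows. -/
theorem expect_gram_insert_le (hn : 0 < n) {I : Finset (Fin n)} {a : Fin n} (ha : a ∉ I) :
    ((n : ℝ) - #I) * 𝔼 σ : Fin d → Equiv.Perm (Fin n),
        principalMinor (centeredSum σ * (centeredSum σ)ᵀ) (insert a I)
      ≤ d * ((n : ℝ) - #I - 1) * 𝔼 σ : Fin d → Equiv.Perm (Fin n),
          principalMinor (centeredSum σ * (centeredSum σ)ᵀ) I := by
  set g : (Fin d → Equiv.Perm (Fin n)) → ℝ := fun σ => (rowsOn σ I * (rowsOn σ I)ᵀ).det with hg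
  have hgI (σ : Fin d → Equiv.Perm (Fin n)) :
      principalMinor (centeredSum σ * (centeredSum σ)ᵀ) I = g σ := rfl
  have hm : 0 < (n : ℝ) - #I := by
    rw [sub_pos]
    have := card_lt_univ_of_notMem ha
    rw [Fintype.card_fin] at this
    exact_mod_cast this
  set m : ℝ := (n : ℝ) - #I with hm_def
  -- `w σ p` is, up to the factor `-1 / m`, the conditional mean of row `a` of the `p`-th matrix.
  let w : (Fin d → Equiv.Perm (Fin n)) → Fin d → Fin n → ℝ :=
    fun σ p => ∑ i ∈ I, centeredRow (σ p) i
  let Q : (Fin d → Equiv.Perm (Fin n)) → Matrix (Fin n) (Fin n) ℝ :=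
    fun σ => rowComplProj (rowsOn σ I)
  have hexp (σ : Fin d → Equiv.Perm (Fin n)) :
      principalMinor (centeredSum σ * (centeredSum σ)ᵀ) (insert a I)
        = ∑ p, g σ * (centeredRow (σ p) a ⬝ᵥ Q σ *ᵥ centeredRow (σ p) a)
          + ∑ p, ∑ q ∈ univ.erase p,
              g σ * (centeredRow (σ p) a ⬝ᵥ Q σ *ᵥ centeredRow (σ q) a) := by
    rw [principalMinor_mul_transpose_insert _ ha, hgI, ← sum_add_distrib]
    have : ∀ p, g σ * (centeredRow (σ p) a ⬝ᵥ Q σ *ᵥ centeredRow (σ p) a)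
        + ∑ q ∈ univ.erase p, g σ * (centeredRow (σ p) a ⬝ᵥ Q σ *ᵥ centeredRow (σ q) a)
        = ∑ q, g σ * (centeredRow (σ p) a ⬝ᵥ Q σ *ᵥ centeredRow (σ q) a) :=
      fun p => add_sum_erase univ
        (fun q => g σ * (centeredRow (σ p) a ⬝ᵥ Q σ *ᵥ centeredRow (σ q) a)) (mem_univ p)
    rw [sum_congr rfl fun p _ => this p]
    simp only [← mul_sum, ← dotProduct_sum, ← sum_dotProduct, ← mulVec_sum, ← centeredSum_row]
    rfl
  have hcross : ∀ p, ∀ q ∈ univ.erase p, 𝔼 σ, g σ *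
      (centeredRow (σ p) a ⬝ᵥ Q σ *ᵥ centeredRow (σ q) a)
      = 𝔼 σ, g σ * (w σ p ⬝ᵥ Q σ *ᵥ w σ q) / m ^ 2 := by
    intro p q hq
    rw [← expect_div, eq_div_iff (by positivity), mul_comm]
    exact sq_mul_expect_cross hn ha (ne_of_mem_erase hq).symm
  have hdiag : ∀ p, 𝔼 σ, g σ * (centeredRow (σ p) a ⬝ᵥ Q σ *ᵥ centeredRow (σ p) a)
      = 𝔼 σ, g σ * (∑ j ∈ Iᶜ, centeredRow (σ p) j ⬝ᵥ Q σ *ᵥ centeredRow (σ p) j) / m := by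
    intro p
    rw [← expect_div, eq_div_iff hm.ne', mul_comm]
    exact mul_expect_diag ha p
  simp only [hexp, expect_add_distrib, expect_sum_comm]
  rw [sum_congr rfl fun p _ => sum_congr rfl (hcross p), sum_congr rfl fun p _ => hdiag p]
  simp only [← expect_sum_comm, ← expect_add_distrib, mul_expect]
  refine expect_le_expect fun σ _ => ?_
  rw [hgI]
  by_cases h0 : g σ = 0
  · simp [h0]
  have hg0 : 0 < g σ := lt_of_le_of_ne (principalMinor_mul_transpose_nonneg (centeredSum σ) I)
    (Ne.symm h0)
  have hu : IsUnit (rowsOn σ I * (rowsOn σ I)ᵀ).det := isUnit_iff_ne_zero.2 h0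
  have hone : Q σ *ᵥ (fun _ => 1) = fun _ => 1 := by
    refine rowComplProj_mulVec_of_mulVec_eq_zero ?_
    ext i
    simpa [mulVec, dotProduct, rowsOn] using sum_centeredSum_row hn σ i
  have hnn (v : Fin n → ℝ) : 0 ≤ v ⬝ᵥ Q σ *ᵥ v := dotProduct_rowComplProj_nonneg hu v
  have hdiag_le (p : Fin d) :
      ∑ j ∈ Iᶜ, centeredRow (σ p) j ⬝ᵥ Q σ *ᵥ centeredRow (σ p) j ≤ m - 1 := by
    refine (sum_le_sum_of_subset_of_nonneg (subset_univ _) fun j _ _ => hnn _).trans ?_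
    rw [sum_centeredRow_dotProduct hn _ hone rowComplProj_transpose, trace_rowComplProj hu,
      Fintype.card_fin, Fintype.card_coe]
  -- The sum of all `w σ p` lies in the span of the rows in `I`.
  have hcross_le : ∑ p, ∑ q ∈ univ.erase p, w σ p ⬝ᵥ Q σ *ᵥ w σ q ≤ 0 := by
    have hw : Q σ *ᵥ (∑ p, w σ p) = 0 := by
      rw [show ∑ p, w σ p = ∑ i : I, (rowsOn σ I).row i by
        rw [sum_comm, ← sum_coe_sort]
        exact sum_congr rfl fun i _ => (centeredSum_row σ i).symm]
      rw [mulVec_sum]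
      exact sum_eq_zero fun i _ => rowComplProj_mulVec_row hu i
    have h1 : ∑ p, ∑ q ∈ univ.erase p, w σ p ⬝ᵥ Q σ *ᵥ w σ q
        = - ∑ p, w σ p ⬝ᵥ Q σ *ᵥ w σ p := by
      rw [eq_neg_iff_add_eq_zero, ← sum_add_distrib]
      have : ∀ p, ∑ q ∈ univ.erase p, w σ p ⬝ᵥ Q σ *ᵥ w σ q + w σ p ⬝ᵥ Q σ *ᵥ w σ p
          = ∑ q, w σ p ⬝ᵥ Q σ *ᵥ w σ q :=
        fun p => sum_erase_add univ (fun q => w σ p ⬝ᵥ Q σ *ᵥ w σ q) (mem_univ p)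
      rw [sum_congr rfl fun p _ => this p]
      simp only [← dotProduct_sum, ← mulVec_sum, hw, dotProduct_zero, sum_const_zero]
    rw [h1, neg_nonpos]
    exact sum_nonneg fun p _ => hnn _
  have e1 : m * (∑ p, g σ * (∑ j ∈ Iᶜ, centeredRow (σ p) j ⬝ᵥ Q σ *ᵥ centeredRow (σ p) j) / m
      + ∑ p, ∑ q ∈ univ.erase p, g σ * (w σ p ⬝ᵥ Q σ *ᵥ w σ q) / m ^ 2)
      = g σ * (∑ p, ∑ j ∈ Iᶜ, centeredRow (σ p) j ⬝ᵥ Q σ *ᵥ centeredRow (σ p) j)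
        + g σ / m * ∑ p, ∑ q ∈ univ.erase p, w σ p ⬝ᵥ Q σ *ᵥ w σ q := by
    simp only [← sum_div, ← mul_sum]
    field_simp
  rw [e1]
  have h2 : ∑ p : Fin d, ∑ j ∈ Iᶜ, centeredRow (σ p) j ⬝ᵥ Q σ *ᵥ centeredRow (σ p) j
      ≤ d * (m - 1) := by
    refine (sum_le_sum fun p _ => hdiag_le p).trans ?_
    rw [sum_const, card_univ, Fintype.card_fin, nsmul_eq_mul]
  have h3 : g σ / m * ∑ p, ∑ q ∈ univ.erase p, w σ p ⬝ᵥ Q σ *ᵥ w σ q ≤ 0 :=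
    mul_nonpos_of_nonneg_of_nonpos (by positivity) hcross_le
  have h4 := mul_le_mul_of_nonneg_left h2 hg0.le
  linarith

theorem expect_gram_le (hn : 0 < n) (I : Finset (Fin n)) :
    𝔼 σ : Fin d → Equiv.Perm (Fin n), principalMinor (centeredSum σ * (centeredSum σ)ᵀ) I
      ≤ (d : ℝ) ^ #I * (((n : ℝ) - #I) / n) := by
  induction I using Finset.induction with
  | empty =>
    have : (n : ℝ) ≠ 0 := by positivity
    simp [principalMinor, this]
  | insert a I ha ih =>
    have h1 : #I + 1 ≤ n := by
      have := card_lt_univ_of_notMem ha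
      rwa [Fintype.card_fin] at this
    have h1' : (#I : ℝ) + 1 ≤ n := by exact_mod_cast h1
    have hm : 0 < (n : ℝ) - #I := by linarith
    have h := expect_gram_insert_le (d := d) hn ha
    rw [card_insert_of_notMem ha]
    refine le_of_mul_le_mul_left (h.trans ?_) hm
    refine (mul_le_mul_of_nonneg_left ih ?_).trans (le_of_eq ?_)
    · exact mul_nonneg (by positivity) (by linarith)
    · push_cast
      ring

end PermSum

/-! ### Second moments for sums of uniform permutation matrices -/

namespace PermSum

open Matrix Finset

open scoped BigOperators

variable {n : ℕ}

theorem secularCoeff_eq_zero_of_lt {k : ℕ} (hk : n < k) (M : Matrix (Fin n) (Fin n) ℝ) :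
    secularCoeff M k = 0 := by
  rw [secularCoeff, powersetCard_eq_empty.2 (by simpa using hk), sum_empty]

theorem expect_secularCoeff_mul_transpose {S : Type*} [Fintype S]
    {X : S → Matrix (Fin n) (Fin n) ℝ} (hX : Exchangeable X) (k : ℕ) :
    (n.choose k : ℝ)
        * ∑ I ∈ powersetCard k (univ : Finset (Fin n)), 𝔼 s, principalMinor (X s) I ^ 2
      = 𝔼 s, secularCoeff (X s * (X s)ᵀ) k := by
  simp only [secularCoeff]
  rw [expect_sum_comm, mul_sum]
  refine sum_congr rfl fun I hI => ?_
  rw [← hX.choose_mul_expect_principalMinor_sq I, (mem_powersetCard.1 hI).2]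

/-- The second moment of the `k`-th secular coefficient of the centered sum of `d` independent
uniform permutation matrices. -/
noncomputable def centeredMoment (n d k : ℕ) : ℝ :=
  𝔼 σ : Fin d → Equiv.Perm (Fin n), secularCoeff (centeredSum σ) k ^ 2

variable {d : ℕ}

theorem centeredMoment_nonneg (n d k : ℕ) : 0 ≤ centeredMoment n d k :=
  expect_nonneg fun _ _ => sq_nonneg _

/-- The second moment of the `k`-th secular coefficient in terms of Gram determinants. -/
theorem choose_mul_centeredMoment (hn : 0 < n) {k : ℕ} (hk : k ≤ n) :
    (n.choose k : ℝ) * (((n : ℝ) - k) * centeredMoment n d k)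
      = n * 𝔼 σ : Fin d → Equiv.Perm (Fin n),
          secularCoeff (centeredSum σ * (centeredSum σ)ᵀ) k := by
  rw [centeredMoment, exchangeable_centeredSum.sub_mul_expect_secularCoeff_sq
    (sum_centeredSum_row hn) (sum_centeredSum_col hn) hk, mul_left_comm,
    expect_secularCoeff_mul_transpose exchangeable_centeredSum]

theorem expect_secularCoeff_gram_le (hn : 0 < n) (k : ℕ) :
    𝔼 σ : Fin d → Equiv.Perm (Fin n), secularCoeff (centeredSum σ * (centeredSum σ)ᵀ) k
      ≤ n.choose k * ((d : ℝ) ^ k * (((n : ℝ) - k) / n)) := by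
  simp only [secularCoeff]
  rw [expect_sum_comm]
  refine (sum_le_card_nsmul _ _ ((d : ℝ) ^ k * (((n : ℝ) - k) / n)) fun I hI => ?_).trans
    (le_of_eq ?_)
  · have := expect_gram_le (d := d) hn I
    rwa [(mem_powersetCard.1 hI).2] at this
  · rw [card_powersetCard, card_univ, Fintype.card_fin, nsmul_eq_mul]

theorem centeredMoment_le (hn : 0 < n) (k : ℕ) : centeredMoment n d k ≤ (d : ℝ) ^ k := by
  have hn' : (0 : ℝ) < n := by exact_mod_cast hn
  have hzero (h : ∀ σ : Fin d → Equiv.Perm (Fin n), secularCoeff (centeredSum σ) k = 0) :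
      centeredMoment n d k ≤ (d : ℝ) ^ k := by
    simp only [centeredMoment, h]
    simp
  rcases lt_trichotomy k n with h | rfl | h
  · have h1 := choose_mul_centeredMoment (d := d) hn h.le
    have h2 := mul_le_mul_of_nonneg_left (expect_secularCoeff_gram_le (d := d) hn k) hn'.le
    rw [← h1] at h2
    have hc : (0 : ℝ) < n.choose k := by exact_mod_cast Nat.choose_pos h.le
    have hk : (0 : ℝ) < (n : ℝ) - k := by
      rw [sub_pos]
      exact_mod_cast h
    refine le_of_mul_le_mul_left ?_ (mul_pos hc hk)
    calc (n.choose k : ℝ) * (n - k) * centeredMoment n d k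
        = n.choose k * ((n - k) * centeredMoment n d k) := by ring
      _ ≤ n * (n.choose k * (d ^ k * ((n - k) / n))) := h2
      _ = n.choose k * (n - k) * d ^ k := by field_simp
  · exact hzero fun σ => sum_eq_zero fun I hI =>
      principalMinor_eq_zero_of_card_eq hn (sum_centeredSum_row hn σ) (mem_powersetCard.1 hI).2
  · exact hzero fun σ => secularCoeff_eq_zero_of_lt h _

theorem expect_secularCoeff_permMatrixSum_sq (hn : 0 < n) (k : ℕ) :
    𝔼 σ : Fin d → Equiv.Perm (Fin n), secularCoeff (permMatrixSum σ) (k + 1) ^ 2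
      = centeredMoment n d (k + 1) + d ^ 2 * centeredMoment n d k := by
  have hn' : (n : ℝ) ≠ 0 := by positivity
  have h (σ : Fin d → Equiv.Perm (Fin n)) : secularCoeff (permMatrixSum σ) (k + 1) ^ 2
      = secularCoeff (centeredSum σ) (k + 1) ^ 2
        + d ^ 2 * secularCoeff (centeredSum σ) k ^ 2
        + 2 * d * (secularCoeff (centeredSum σ) (k + 1) * secularCoeff (centeredSum σ) k) := by
    rw [permMatrixSum_eq, secularCoeff_add_constMatrix (sum_centeredSum_row hn σ)]
    field_simp
    ring
  simp only [h, expect_add_distrib, ← mul_expect]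
  rw [exchangeable_centeredSum.expect_secularCoeff_succ_mul (sum_centeredSum_col hn), mul_zero,
    add_zero]
  rfl

theorem sum_expect_principalMinor_sq (hn : 0 < n) {k : ℕ} (hk : k + 1 ≤ n) :
    n * ∑ I ∈ powersetCard (k + 1) (univ : Finset (Fin n)),
        𝔼 σ : Fin d → Equiv.Perm (Fin n), principalMinor (permMatrixSum σ) I ^ 2
      = (n - (k + 1)) * centeredMoment n d (k + 1)
        + d ^ 2 * ((k + 1) * centeredMoment n d k) := by
  have hn' : (n : ℝ) ≠ 0 := by positivity
  have hc : (n.choose (k + 1) : ℝ) ≠ 0 := by exact_mod_cast (Nat.choose_pos hk).ne'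
  refine mul_left_cancel₀ hc ?_
  rw [mul_left_comm, expect_secularCoeff_mul_transpose exchangeable_permMatrixSum]
  have h (σ : Fin d → Equiv.Perm (Fin n)) :
      secularCoeff (permMatrixSum σ * (permMatrixSum σ)ᵀ) (k + 1)
      = secularCoeff (centeredSum σ * (centeredSum σ)ᵀ) (k + 1)
        + d ^ 2 * secularCoeff (centeredSum σ * (centeredSum σ)ᵀ) k := by
    rw [permMatrixSum_eq, mul_transpose_add_constMatrix (sum_centeredSum_row hn σ),
      secularCoeff_add_constMatrix (sum_mul_transpose_eq_zero (sum_centeredSum_col hn σ))]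
    field_simp
  simp only [h, expect_add_distrib, ← mul_expect]
  have h1 := choose_mul_centeredMoment (d := d) hn hk
  have h2 := choose_mul_centeredMoment (d := d) hn (Nat.le_of_succ_le hk)
  have h3 : (n.choose (k + 1) : ℝ) * (k + 1) = n.choose k * (n - k) := by
    have := Nat.choose_succ_right_eq n k
    rw [← Nat.cast_sub (Nat.le_of_succ_le hk)]
    exact_mod_cast this
  push_cast at h1
  linear_combination (-1 : ℝ) * h1 - d ^ 2 * h2 - d ^ 2 * centeredMoment n d k * h3

theorem expect_secularCoeff_permMatrixSum_sq_le (hn : 0 < n) (k : ℕ) :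
    𝔼 σ : Fin d → Equiv.Perm (Fin n), secularCoeff (permMatrixSum σ) k ^ 2
      ≤ (d : ℝ) ^ k + d ^ (k + 1) := by
  cases k with
  | zero => simp
  | succ k =>
    rw [expect_secularCoeff_permMatrixSum_sq hn]
    have h1 := centeredMoment_le (d := d) hn (k + 1)
    have h2 := mul_le_mul_of_nonneg_left (centeredMoment_le (d := d) hn k) (sq_nonneg (d : ℝ))
    calc _ ≤ (d : ℝ) ^ (k + 1) + d ^ 2 * d ^ k := add_le_add h1 h2
      _ = _ := by ring

theorem sum_expect_principalMinor_sq_le (hn : 0 < n) {k : ℕ} (hk1 : 1 ≤ k) (hk : k ≤ n) :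
    ∑ I ∈ powersetCard k (univ : Finset (Fin n)),
        𝔼 σ : Fin d → Equiv.Perm (Fin n), principalMinor (permMatrixSum σ) I ^ 2
      ≤ (d : ℝ) ^ k * (1 + d * k / n) := by
  obtain ⟨k, rfl⟩ := Nat.exists_eq_add_of_le' hk1
  have hn' : (0 : ℝ) < n := by exact_mod_cast hn
  refine le_of_mul_le_mul_left ?_ hn'
  rw [sum_expect_principalMinor_sq hn hk]
  have h1 := centeredMoment_le (d := d) hn (k + 1)
  have h2 := centeredMoment_le (d := d) hn k
  have hk' : (k : ℝ) + 1 ≤ n := by exact_mod_cast hk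
  have hk0 : (0 : ℝ) ≤ k := by positivity
  have hdk : (0 : ℝ) ≤ (d : ℝ) ^ (k + 1) := by positivity
  calc (n - (k + 1)) * centeredMoment n d (k + 1) + d ^ 2 * ((k + 1) * centeredMoment n d k)
      ≤ (n - (k + 1)) * (d : ℝ) ^ (k + 1) + d ^ 2 * ((k + 1) * d ^ k) := by
        gcongr
    _ ≤ n * (d : ℝ) ^ (k + 1) + d ^ 2 * ((k + 1) * d ^ k) := by
        gcongr
        linarith
    _ = n * ((d : ℝ) ^ (k + 1) * (1 + d * ((k + 1 : ℕ) : ℝ) / n)) := by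
        push_cast
        field_simp
        ring

theorem abs_sum_expect_principalMinor_mul_le (hn : 0 < n) (hd : 1 ≤ d) {k : ℕ} (hk1 : 1 ≤ k)
    (hk : k ≤ n) :
    |∑ I ∈ powersetCard k (univ : Finset (Fin n)),
        ∑ J ∈ (powersetCard k (univ : Finset (Fin n))).filter (fun J => #(I ∩ J) = k - 1),
          𝔼 σ : Fin d → Equiv.Perm (Fin n),
            principalMinor (permMatrixSum σ) I * principalMinor (permMatrixSum σ) J|
      ≤ (d : ℝ) ^ (k + 1) := by
  have h := (exchangeable_permMatrixSum (n := n) (d := d)).expect_secularCoeff_sq hk1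
  obtain ⟨k, rfl⟩ := Nat.exists_eq_add_of_le' hk1
  rw [expect_secularCoeff_permMatrixSum_sq hn] at h
  have hS := sum_expect_principalMinor_sq (d := d) hn hk
  set T := ∑ I ∈ powersetCard (k + 1) (univ : Finset (Fin n)),
    ∑ J ∈ (powersetCard (k + 1) (univ : Finset (Fin n))).filter (fun J => #(I ∩ J) = k + 1 - 1),
      𝔼 σ : Fin d → Equiv.Perm (Fin n),
        principalMinor (permMatrixSum σ) I * principalMinor (permMatrixSum σ) J
  have hT : n * T = (k + 1) * centeredMoment n d (k + 1)
      + (n - (k + 1)) * (d ^ 2 * centeredMoment n d k) := by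
    linear_combination (-(n : ℝ)) * h - hS
  have hn' : (0 : ℝ) < n := by exact_mod_cast hn
  have hd' : (1 : ℝ) ≤ d := by exact_mod_cast hd
  have hk' : (k : ℝ) + 1 ≤ n := by exact_mod_cast hk
  have hk0 : (0 : ℝ) ≤ k := by positivity
  have p1 := centeredMoment_nonneg n d (k + 1)
  have p2 := centeredMoment_nonneg n d k
  have hT0 : 0 ≤ n * T := by
    rw [hT]
    have : 0 ≤ (n : ℝ) - (k + 1) := by linarith
    positivity
  rw [abs_of_nonneg (nonneg_of_mul_nonneg_right hT0 hn')]
  refine le_of_mul_le_mul_left ?_ hn'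
  rw [hT]
  have h1 : centeredMoment n d (k + 1) ≤ (d : ℝ) ^ (k + 1 + 1) :=
    (centeredMoment_le hn (k + 1)).trans (pow_le_pow_right₀ hd' (Nat.le_succ _))
  have h2 : (d : ℝ) ^ 2 * centeredMoment n d k ≤ (d : ℝ) ^ (k + 1 + 1) := by
    refine (mul_le_mul_of_nonneg_left (centeredMoment_le (d := d) hn k) (sq_nonneg _)).trans
      (le_of_eq ?_)
    ring
  calc (k + 1) * centeredMoment n d (k + 1) + (n - (k + 1)) * (d ^ 2 * centeredMoment n d k)
      ≤ (k + 1) * (d : ℝ) ^ (k + 1 + 1) + (n - (k + 1)) * (d : ℝ) ^ (k + 1 + 1) := by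
        gcongr
    _ = n * (d : ℝ) ^ (k + 1 + 1) := by ring

end PermSum

/-! ### Generating functions of the second moments -/

namespace PermSum

open Finset

open scoped BigOperators

theorem sum_Icc_pow_le {r : ℝ} (h0 : 0 < r) (h1 : r < 1) (n : ℕ) :
    ∑ k ∈ Icc 1 n, r ^ k ≤ r / (1 - r) := by
  have h : HasSum (fun k : ℕ => r ^ (k + 1)) (r / (1 - r)) := by
    have := (hasSum_geometric_of_lt_one h0.le h1).mul_left r
    simpa [pow_succ', div_eq_mul_inv] using this
  have e : ∑ k ∈ Icc 1 n, r ^ k = ∑ k ∈ range n, r ^ (k + 1) := by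
    rw [range_eq_Ico, sum_Ico_add' (fun k => r ^ k) 0 n 1]
    rfl
  rw [e]
  exact sum_le_hasSum _ (fun k _ => by positivity) h

theorem sum_Icc_mul_pow_le {r : ℝ} (h0 : 0 < r) (h1 : r < 1) (n : ℕ) :
    ∑ k ∈ Icc 1 n, k * r ^ k ≤ r / (1 - r) ^ 2 :=
  sum_le_hasSum _ (fun k _ => by positivity)
    (hasSum_coe_mul_geometric_of_norm_lt_one (by rwa [Real.norm_of_nonneg h0.le]))

/-- The assumption on `d` says exactly that the denominators of the bounds are positive. -/
theorem gap_pos {n d : ℕ} {r : ℝ} (hn : 0 < n) (h0 : 0 < r)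
    (h : (d : ℝ) < Real.sqrt (n * (1 - r) / r)) : 0 < 1 - r - r * (d : ℝ) ^ 2 / n := by
  have hn' : (0 : ℝ) < n := by exact_mod_cast hn
  rw [Real.lt_sqrt (by positivity), lt_div_iff₀ h0] at h
  rw [sub_pos, div_lt_iff₀ hn']
  linarith

variable {n d : ℕ} {r : ℝ}

theorem sum_expect_secularCoeff_sq_le (hn : 0 < n) (h0 : 0 < r) (h1 : r < 1) (hd : 1 ≤ d)
    (h : (d : ℝ) < Real.sqrt (n * (1 - r) / r)) :
    ∑ k ∈ range (n + 1), r ^ k / (d : ℝ) ^ (k + 1) *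
        𝔼 σ : Fin d → Equiv.Perm (Fin n), secularCoeff (permMatrixSum σ) k ^ 2
      ≤ (2 / (d : ℝ) + r) / (1 - r - r * (d : ℝ) ^ 2 / n) ^ 2 := by
  have hgap := gap_pos hn h0 h
  set D := 1 - r - r * (d : ℝ) ^ 2 / n with hD
  have hd' : (1 : ℝ) ≤ d := by exact_mod_cast hd
  have hd0 : (0 : ℝ) < d := by linarith
  have hDr : D ≤ 1 - r := by
    have : 0 ≤ r * (d : ℝ) ^ 2 / n := by positivity
    linarith
  have hD2 : D ^ 2 ≤ 1 - r := by nlinarith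
  have hr : 0 < 1 - r := by linarith
  have e : range (n + 1) = insert 0 (Icc 1 n) := by
    ext k
    simp only [Finset.mem_range, Finset.mem_insert, Finset.mem_Icc]
    omega
  have hterm : ∀ k ∈ Icc 1 n, r ^ k / (d : ℝ) ^ (k + 1) *
      𝔼 σ : Fin d → Equiv.Perm (Fin n), secularCoeff (permMatrixSum σ) k ^ 2
      ≤ r ^ k * (1 / d + 1) := by
    intro k _
    refine (mul_le_mul_of_nonneg_left (expect_secularCoeff_permMatrixSum_sq_le hn k)
      (by positivity)).trans (le_of_eq ?_)
    field_simp
    ring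
  rw [e, sum_insert (by simp)]
  have hsum := (sum_le_sum hterm).trans_eq (sum_mul _ _ _).symm
  have hgeom := mul_le_mul_of_nonneg_right (sum_Icc_pow_le h0 h1 n)
    (show (0 : ℝ) ≤ 1 / d + 1 by positivity)
  have hzero : r ^ 0 / (d : ℝ) ^ (0 + 1) *
      𝔼 σ : Fin d → Equiv.Perm (Fin n), secularCoeff (permMatrixSum σ) 0 ^ 2 = 1 / d := by
    simp
  rw [hzero]
  calc _ ≤ 1 / (d : ℝ) + r / (1 - r) * (1 / d + 1) := by linarith
    _ = (1 / d + r) / (1 - r) := by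
      field_simp
      ring
    _ ≤ (2 / d + r) / (1 - r) := by
      gcongr
      norm_num
    _ ≤ (2 / d + r) / D ^ 2 := by gcongr

theorem sum_sum_expect_principalMinor_sq_le (hn : 0 < n) (h0 : 0 < r) (h1 : r < 1) (hd : 1 ≤ d)
    (h : (d : ℝ) < Real.sqrt (n * (1 - r) / r)) :
    ∑ k ∈ Icc 1 n, r ^ k / (d : ℝ) ^ k * ∑ I ∈ powersetCard k (univ : Finset (Fin n)),
        𝔼 σ : Fin d → Equiv.Perm (Fin n), principalMinor (permMatrixSum σ) I ^ 2
      ≤ 2 / (1 - r - r * (d : ℝ) ^ 2 / n) := by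
  have hgap := gap_pos hn h0 h
  set D := 1 - r - r * (d : ℝ) ^ 2 / n with hD
  have hd' : (1 : ℝ) ≤ d := by exact_mod_cast hd
  have hn' : (0 : ℝ) < n := by exact_mod_cast hn
  have hDr : D ≤ 1 - r := by
    have : 0 ≤ r * (d : ℝ) ^ 2 / n := by positivity
    linarith
  have hr : 0 < 1 - r := by linarith
  have hterm : ∀ k ∈ Icc 1 n, r ^ k / (d : ℝ) ^ k * ∑ I ∈ powersetCard k (univ : Finset (Fin n)),
      𝔼 σ : Fin d → Equiv.Perm (Fin n), principalMinor (permMatrixSum σ) I ^ 2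
      ≤ r ^ k + d / n * (k * r ^ k) := by
    intro k hk
    rw [Finset.mem_Icc] at hk
    refine (mul_le_mul_of_nonneg_left (sum_expect_principalMinor_sq_le hn hk.1 hk.2)
      (by positivity)).trans (le_of_eq ?_)
    field_simp
  refine (sum_le_sum hterm).trans ?_
  rw [sum_add_distrib, ← mul_sum]
  have hdn : d / n * r ≤ 1 - r := by
    have : (d : ℝ) / n * r ≤ r * d ^ 2 / n := by
      rw [div_mul_eq_mul_div]
      refine div_le_div_of_nonneg_right ?_ hn'.le
      nlinarith [mul_nonneg (mul_nonneg h0.le (zero_le_one.trans hd')) (sub_nonneg.2 hd')]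
    linarith
  calc _ ≤ r / (1 - r) + d / n * (r / (1 - r) ^ 2) := by
        gcongr
        · exact sum_Icc_pow_le h0 h1 n
        · exact sum_Icc_mul_pow_le h0 h1 n
    _ = r / (1 - r) + (d / n * r) / (1 - r) ^ 2 := by ring
    _ ≤ r / (1 - r) + (1 - r) / (1 - r) ^ 2 := by gcongr
    _ = (r + 1) / (1 - r) := by
        field_simp
    _ ≤ 2 / (1 - r) := by
        gcongr
        linarith
    _ ≤ 2 / D := by gcongr

theorem sum_abs_sum_expect_principalMinor_mul_le (hn : 0 < n) (h0 : 0 < r) (h1 : r < 1)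
    (hd : 1 ≤ d) (h : (d : ℝ) < Real.sqrt (n * (1 - r) / r)) :
    ∑ k ∈ Icc 1 n, r ^ k / (d : ℝ) ^ (k + 1) * |∑ I ∈ powersetCard k (univ : Finset (Fin n)),
        ∑ J ∈ (powersetCard k (univ : Finset (Fin n))).filter (fun J => #(I ∩ J) = k - 1),
          𝔼 σ : Fin d → Equiv.Perm (Fin n),
            principalMinor (permMatrixSum σ) I * principalMinor (permMatrixSum σ) J|
      ≤ r / (1 - r - r * (d : ℝ) ^ 2 / n) ^ 2 := by
  have hgap := gap_pos hn h0 h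
  set D := 1 - r - r * (d : ℝ) ^ 2 / n with hD
  have hd' : (1 : ℝ) ≤ d := by exact_mod_cast hd
  have hDr : D ≤ 1 - r := by
    have : 0 ≤ r * (d : ℝ) ^ 2 / n := by positivity
    linarith
  have hD2 : D ^ 2 ≤ 1 - r := by nlinarith
  have hterm := fun k (hk : k ∈ Icc 1 n) =>
    mul_le_mul_of_nonneg_left (abs_sum_expect_principalMinor_mul_le hn hd
      (Finset.mem_Icc.1 hk).1 (Finset.mem_Icc.1 hk).2)
      (show 0 ≤ r ^ k / (d : ℝ) ^ (k + 1) by positivity)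
  refine (sum_le_sum hterm).trans ?_
  have e : ∀ k, r ^ k / (d : ℝ) ^ (k + 1) * (d : ℝ) ^ (k + 1) = r ^ k :=
    fun k => div_mul_cancel₀ _ (by positivity)
  simp only [e]
  calc _ ≤ r / (1 - r) := sum_Icc_pow_le h0 h1 n
    _ ≤ r / D ^ 2 := by gcongr

/-! ### Expectations over independent uniform permutations -/

/-- Expectations with respect to independent uniform permutations are finite averages. -/
theorem integral_eq_expect {Ω : Type u} [MeasurableSpace Ω] {P : Measure Ω}
    [IsProbabilityMeasure P] {π : Fin d → Ω → Equiv.Perm (Fin n)} (hπ : IsIIDUniformPerms P π)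
    (F : (Fin d → Equiv.Perm (Fin n)) → ℝ) :
    ∫ ω, F (fun q => π q ω) ∂P = 𝔼 σ, F σ := by
  let _ : MeasurableSpace (Equiv.Perm (Fin n)) := ⊤
  have hm : Measurable fun ω q => π q ω := measurable_pi_lambda _ hπ.measurable
  have hF : Measurable F := measurable_of_finite F
  have hprob : IsProbabilityMeasure (P.map fun ω q => π q ω) :=
    Measure.isProbabilityMeasure_map hm.aemeasurable
  have hmass (σ : Fin d → Equiv.Perm (Fin n)) : (P.map fun ω q => π q ω).real {σ}
      = (Fintype.card (Fin d → Equiv.Perm (Fin n)) : ℝ)⁻¹ := by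
    rw [map_measureReal_apply hm (measurableSet_singleton σ)]
    have h := hπ.indep.measure_inter_preimage_eq_mul univ (sets := fun q => {σ q})
      (fun q _ => measurableSet_singleton _)
    have e : (fun ω q => π q ω) ⁻¹' {σ} = ⋂ q ∈ (univ : Finset (Fin d)), π q ⁻¹' {σ q} := by
      ext ω
      simp [funext_iff]
    rw [e, Measure.real, h]
    have hq : ∀ q, P (π q ⁻¹' {σ q}) = ((n.factorial : ℕ) : ENNReal)⁻¹ := fun q =>
      hπ.uniform q (σ q)
    simp [hq, Fintype.card_perm]
  rw [← integral_map (f := F) hm.aemeasurable hF.aestronglyMeasurable, integral_fintype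
    Integrable.of_finite, Fintype.expect_eq_sum_div_card, sum_div]
  refine sum_congr rfl fun σ _ => ?_
  rw [hmass, smul_eq_mul, div_eq_inv_mul]

end PermSum

/-! ### The space of analytic functions on the unit disk -/

namespace PermSum

open scoped BigOperators

instance : LocallyCompactSpace unitDisk := Metric.isOpen_ball.locallyCompactSpace

theorem isEmbedding_val_holDisk : IsEmbedding (Subtype.val : HolDisk → C(unitDisk, ℂ)) :=
  IsEmbedding.subtypeVal

instance : T2Space HolDisk := isEmbedding_val_holDisk.t2Space

instance : TopologicalSpace.PseudoMetrizableSpace HolDisk :=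
  isEmbedding_val_holDisk.isInducing.pseudoMetrizableSpace

instance : SecondCountableTopology HolDisk :=
  isEmbedding_val_holDisk.secondCountableTopology

/-- Coefficient sequences of power series that grow at most linearly. -/
abbrev LinearGrowth (c : ℝ) : Set (ℕ → ℂ) :=
  Set.pi Set.univ fun k => Metric.closedBall 0 (c * (k + 1))

theorem summable_linear_mul_pow (c : ℝ) {ρ : ℝ} (h0 : 0 ≤ ρ) (h1 : ρ < 1) :
    Summable fun k : ℕ => c * (k + 1) * ρ ^ k := by
  have h := (hasSum_coe_mul_geometric_of_norm_lt_one
    (show ‖ρ‖ < 1 by rwa [Real.norm_of_nonneg h0])).summable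
  have h2 := summable_geometric_of_lt_one h0 h1
  refine ((h.add h2).mul_left c).congr fun k => ?_
  ring

theorem norm_mul_pow_le {c : ℝ} {b : ℕ → ℂ} (hb : b ∈ LinearGrowth c) {ρ : ℝ} {z : ℂ}
    (hz : ‖z‖ ≤ ρ) (k : ℕ) : ‖b k * z ^ k‖ ≤ c * (k + 1) * ρ ^ k := by
  have h := hb k (Set.mem_univ k)
  rw [mem_closedBall_zero_iff] at h
  rw [norm_mul, norm_pow]
  have := norm_nonneg z
  have := (norm_nonneg (b k)).trans h
  gcongr

theorem exists_norm_lt_lt_one (z : unitDisk) : ∃ ρ : ℝ, 0 ≤ ρ ∧ ρ < 1 ∧ ‖(z : ℂ)‖ < ρ := by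
  obtain ⟨ρ, h1, h2⟩ := exists_between (mem_ball_zero_iff.1 z.2)
  exact ⟨ρ, (norm_nonneg _).trans h1.le, h2, h1⟩

theorem analyticOnNhd_tsum {c : ℝ} {b : ℕ → ℂ} (hb : b ∈ LinearGrowth c) :
    AnalyticOnNhd ℂ (fun z => ∑' k, b k * z ^ k) unitDisk := by
  refine DifferentiableOn.analyticOnNhd (fun z hz => ?_) Metric.isOpen_ball
  obtain ⟨ρ, h0, h1, hzρ⟩ := exists_norm_lt_lt_one ⟨z, hz⟩
  have h := Complex.differentiableOn_tsum_of_summable_norm (F := fun k z => b k * z ^ k)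
    (summable_linear_mul_pow c h0 h1) (fun k => by fun_prop) Metric.isOpen_ball
    (fun k w hw => norm_mul_pow_le hb (mem_ball_zero_iff.1 hw).le k)
  exact (h.differentiableAt (Metric.isOpen_ball.mem_nhds
    (mem_ball_zero_iff.2 hzρ))).differentiableWithinAt

theorem continuous_uncurry_tsum (c : ℝ) :
    Continuous fun p : LinearGrowth c × unitDisk =>
      ∑' k, (p.1 : ℕ → ℂ) k * (p.2 : ℂ) ^ k := by
  rw [continuous_iff_continuousAt]
  rintro ⟨b, z⟩
  obtain ⟨ρ, h0, h1, hz⟩ := exists_norm_lt_lt_one z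
  have hopen : IsOpen {p : LinearGrowth c × unitDisk | ‖(p.2 : ℂ)‖ < ρ} :=
    isOpen_lt (by fun_prop) continuous_const
  refine ContinuousOn.continuousAt (s := {p : LinearGrowth c × unitDisk | ‖(p.2 : ℂ)‖ < ρ}) ?_
    (hopen.mem_nhds hz)
  refine continuousOn_tsum (fun k => ?_) (summable_linear_mul_pow c h0 h1)
    fun k p hp => norm_mul_pow_le p.1.2 (le_of_lt hp) k
  have : Continuous fun p : LinearGrowth c × unitDisk => (p.1 : ℕ → ℂ) k :=
    (continuous_apply k).comp (continuous_subtype_val.comp continuous_fst)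
  fun_prop

/-- The analytic function on the unit disk with a given sequence of Taylor coefficients. -/
noncomputable def powerSeriesHol (c : ℝ) (b : LinearGrowth c) : HolDisk :=
  ⟨⟨fun z => ∑' k, (b : ℕ → ℂ) k * (z : ℂ) ^ k,
      (continuous_uncurry_tsum c).comp (Continuous.prodMk_right b)⟩,
    _, analyticOnNhd_tsum b.2, fun _ => rfl⟩

theorem continuous_powerSeriesHol (c : ℝ) : Continuous (powerSeriesHol c) :=
  isEmbedding_val_holDisk.isInducing.continuous_iff.2
    (ContinuousMap.continuous_of_continuous_uncurry _ (continuous_uncurry_tsum c))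

/-- A bound on the Taylor coefficients at the origin defines a compact set of analytic functions,
the continuous image of a product of closed disks. -/
theorem isCompact_range_powerSeriesHol (c : ℝ) : IsCompact (Set.range (powerSeriesHol c)) := by
  have : CompactSpace (LinearGrowth c) :=
    isCompact_iff_compactSpace.1 (isCompact_univ_pi fun k => isCompact_closedBall _ _)
  exact isCompact_range (continuous_powerSeriesHol c)

/-! ### The Taylor coefficients of the rescaled characteristic polynomial -/

/-- The `k`-th Taylor coefficient of the rescaled characteristic polynomial, up to sign. -/
noncomputable def rescaledCoeff {n : ℕ} (d : ℕ) (A : Matrix (Fin n) (Fin n) ℝ) (k : ℕ) : ℝ :=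
  secularCoeff A k / Real.sqrt d ^ (k + 1)

theorem rescaledCoeff_sq {n : ℕ} (d : ℕ) (A : Matrix (Fin n) (Fin n) ℝ) (k : ℕ) :
    rescaledCoeff d A k ^ 2 = secularCoeff A k ^ 2 / (d : ℝ) ^ (k + 1) := by
  rw [rescaledCoeff, div_pow, ← pow_mul, mul_comm (k + 1), pow_mul, Real.sq_sqrt (by positivity)]

theorem det_one_add_smul_map_ofReal {n : ℕ} (A : Matrix (Fin n) (Fin n) ℝ) (w : ℂ) :
    (1 + w • A.map (fun x : ℝ => (x : ℂ))).det
      = ∑ k ∈ Finset.range (n + 1), (secularCoeff A k : ℂ) * w ^ k := by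
  set p := Matrix.det (1 + (Polynomial.X : Polynomial ℝ) • A.map Polynomial.C) with hp
  have hdeg : p.natDegree < n + 1 := by
    rw [Nat.lt_succ_iff, Polynomial.natDegree_le_iff_coeff_eq_zero]
    intro k hk
    rw [hp, ← secularCoeff_eq_coeff, secularCoeff_eq_zero_of_lt hk]
  have h := Polynomial.eval₂_eq_sum_range' Complex.ofRealHom hdeg w
  rw [← Polynomial.coe_eval₂RingHom, hp, RingHom.map_det] at h
  simp only [← secularCoeff_eq_coeff] at h
  refine Eq.trans ?_ h
  congr 1
  ext i j
  simp only [Matrix.add_apply, Matrix.smul_apply, Matrix.map_apply, RingHom.mapMatrix_apply]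
  simp [Matrix.one_apply, apply_ite]
  ring

theorem rescaledCharpoly_eq_tsum {n : ℕ} (d : ℕ) (A : Matrix (Fin n) (Fin n) ℝ) (z : ℂ) :
    rescaledCharpoly d A z = ∑' k, ((-1) ^ k * (rescaledCoeff d A k : ℂ)) * z ^ k := by
  rw [tsum_eq_sum (s := Finset.range (n + 1))]
  · have h := det_one_add_smul_map_ofReal A (-(z / ((Real.sqrt d : ℝ) : ℂ)))
    rw [neg_smul, ← sub_eq_add_neg] at h
    rw [rescaledCharpoly, h, Finset.mul_sum]
    refine Finset.sum_congr rfl fun k _ => ?_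
    rw [rescaledCoeff, neg_pow, div_pow]
    push_cast
    rw [pow_succ]
    ring
  · intro k hk
    rw [Finset.mem_range, not_lt] at hk
    rw [rescaledCoeff, secularCoeff_eq_zero_of_lt hk]
    simp

theorem rescaledCharpolyHol_mem_range {n : ℕ} {d : ℕ} {A : Matrix (Fin n) (Fin n) ℝ} {c : ℝ}
    (h : ∀ k, |rescaledCoeff d A k| ≤ c * (k + 1)) :
    rescaledCharpolyHol d A ∈ Set.range (powerSeriesHol c) := by
  refine ⟨⟨fun k => (-1) ^ k * (rescaledCoeff d A k : ℂ), fun k _ => ?_⟩, ?_⟩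
  · rw [mem_closedBall_zero_iff]
    simpa using h k
  · refine Subtype.ext (ContinuousMap.ext fun z => ?_)
    exact (rescaledCharpoly_eq_tsum d A z).symm

/-! ### Tightness and convergence along subsequences -/

theorem sum_one_div_sq_le (n : ℕ) : ∑ k ∈ Finset.range (n + 1), 1 / ((k : ℝ) + 1) ^ 2 ≤ 2 := by
  have h : ∀ n : ℕ, ∑ k ∈ Finset.range (n + 1), 1 / ((k : ℝ) + 1) ^ 2 ≤ 2 - 1 / ((n : ℝ) + 1) := by
    intro n
    induction n with
    | zero => norm_num
    | succ n ih =>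
      rw [Finset.sum_range_succ]
      have e : 1 / (((n + 1 : ℕ) : ℝ) + 1) ^ 2 ≤ 1 / ((n : ℝ) + 1) - 1 / (((n + 1 : ℕ) : ℝ) + 1) := by
        push_cast
        rw [div_sub_div _ _ (by positivity) (by positivity), div_le_div_iff₀ (by positivity)
          (by positivity)]
        nlinarith
      linarith
  have : (0 : ℝ) ≤ 1 / ((n : ℝ) + 1) := by positivity
  linarith [h n]

section

variable {Ω : Type u} [MeasurableSpace Ω] {P : Measure Ω} {n d : ℕ}
  {π : Fin d → Ω → Equiv.Perm (Fin n)}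

theorem measurable_comp_perms (hπ : IsIIDUniformPerms P π) {β : Type*} [MeasurableSpace β]
    (F : (Fin d → Equiv.Perm (Fin n)) → β) : Measurable fun ω => F fun q => π q ω := by
  let _ : MeasurableSpace (Equiv.Perm (Fin n)) := ⊤
  have hm : Measurable fun ω q => π q ω := measurable_pi_lambda _ hπ.measurable
  exact (measurable_of_finite F).comp hm

/-- By the uniform bound on the second moments of the Taylor coefficients and Markov's inequality,
these coefficients satisfy a linear growth bound with probability close to one. -/
theorem measureReal_rescaledCharpolyHol_mem [IsProbabilityMeasure P]
    (hπ : IsIIDUniformPerms P π) (hn : 0 < n) (hd : 1 ≤ d) {c : ℝ} (hc : 0 < c) :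
    1 - 4 / c ^ 2 ≤ P.real {ω | rescaledCharpolyHol d (permMatrixSum fun q => π q ω)
      ∈ Set.range (powerSeriesHol c)} := by
  let Y : (Fin d → Equiv.Perm (Fin n)) → ℝ := fun σ => ∑ k ∈ Finset.range (n + 1),
    rescaledCoeff d (permMatrixSum σ) k ^ 2 / ((k : ℝ) + 1) ^ 2
  have hY0 (σ : Fin d → Equiv.Perm (Fin n)) : 0 ≤ Y σ :=
    Finset.sum_nonneg fun k _ => by positivity
  have hd' : (1 : ℝ) ≤ d := by exact_mod_cast hd
  have hcoeff (k : ℕ) :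
      𝔼 σ : Fin d → Equiv.Perm (Fin n), rescaledCoeff d (permMatrixSum σ) k ^ 2 ≤ 2 := by
    simp only [rescaledCoeff_sq]
    rw [← Finset.expect_div, div_le_iff₀ (by positivity)]
    refine (expect_secularCoeff_permMatrixSum_sq_le hn k).trans ?_
    have := pow_le_pow_right₀ hd' (Nat.le_succ k)
    rw [Nat.succ_eq_add_one] at this
    linarith
  have hEY : ∫ ω, Y (fun q => π q ω) ∂P ≤ 4 := by
    rw [integral_eq_expect hπ, Finset.expect_sum_comm]
    calc _ ≤ ∑ k ∈ Finset.range (n + 1), 2 * (1 / ((k : ℝ) + 1) ^ 2) := by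
          refine Finset.sum_le_sum fun k _ => ?_
          rw [← Finset.expect_div, mul_one_div]
          exact div_le_div_of_nonneg_right (hcoeff k) (by positivity)
      _ ≤ 4 := by
          rw [← Finset.mul_sum]
          linarith [sum_one_div_sq_le n]
  have hYm : Measurable fun ω => Y fun q => π q ω := measurable_comp_perms hπ Y
  have hYint : Integrable (fun ω => Y fun q => π q ω) P := by
    obtain ⟨B, hB⟩ := (Set.finite_range Y).bddAbove
    refine Integrable.of_bound hYm.aestronglyMeasurable B (Eventually.of_forall fun ω => ?_)
    rw [Real.norm_of_nonneg (hY0 _)]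
    exact hB ⟨_, rfl⟩
  have hmarkov := mul_meas_ge_le_integral_of_nonneg
    (Eventually.of_forall fun ω => hY0 fun q => π q ω) hYint (c ^ 2)
  set s := {ω | c ^ 2 ≤ Y fun q => π q ω} with hs
  have hsm : MeasurableSet s := measurableSet_le measurable_const hYm
  have hps : P.real s ≤ 4 / c ^ 2 := by
    rw [le_div_iff₀ (by positivity), mul_comm]
    exact hmarkov.trans hEY
  have hsub : sᶜ ⊆ {ω | rescaledCharpolyHol d (permMatrixSum fun q => π q ω)
      ∈ Set.range (powerSeriesHol c)} := by
    intro ω hω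
    refine rescaledCharpolyHol_mem_range fun k => ?_
    rcases lt_or_ge n k with hk | hk
    · rw [rescaledCoeff, secularCoeff_eq_zero_of_lt hk, zero_div, abs_zero]
      positivity
    · have h1 : rescaledCoeff d (permMatrixSum fun q => π q ω) k ^ 2 / ((k : ℝ) + 1) ^ 2
          ≤ Y fun q => π q ω :=
        Finset.single_le_sum (f := fun k : ℕ =>
          rescaledCoeff d (permMatrixSum fun q => π q ω) k ^ 2 / ((k : ℝ) + 1) ^ 2)
          (fun k _ => by positivity) (Finset.mem_range.2 (Nat.lt_succ_of_le hk))
      have h2 : Y (fun q => π q ω) < c ^ 2 := not_le.1 hω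
      have h3 := h1.trans h2.le
      rw [div_le_iff₀ (by positivity), ← mul_pow] at h3
      exact abs_le_of_sq_le_sq h3 (by positivity)
  refine le_trans ?_ (measureReal_mono hsub)
  rw [probReal_compl_eq_one_sub hsm]
  linarith

end

theorem exists_isCompact_forall_lt {d : ℕ → ℕ} {Ω : ℕ → Type u} [∀ n, MeasurableSpace (Ω n)]
    {P : ∀ n, Measure (Ω n)} [∀ n, IsProbabilityMeasure (P n)]
    {π : ∀ n, Fin (d n) → Ω n → Equiv.Perm (Fin n)} (hπ : ∀ n, IsIIDUniformPerms (P n) (π n))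
    (hd : ∀ n, 1 ≤ n → 1 ≤ d n) {ε : ℝ} (hε : 0 < ε) :
    ∃ K : Set HolDisk, IsCompact K ∧ ∀ n, 1 ≤ n →
      1 - ε < (P n).real {ω | rescaledCharpolyHol (d n) (permMatrixSum fun q => π n q ω) ∈ K} := by
  have hc : 0 < Real.sqrt (5 / ε) := by positivity
  refine ⟨_, isCompact_range_powerSeriesHol (Real.sqrt (5 / ε)), fun n hn => ?_⟩
  refine lt_of_lt_of_le ?_ (measureReal_rescaledCharpolyHol_mem (hπ n) hn (hd n hn) hc)
  rw [Real.sq_sqrt (by positivity)]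
  have : 4 / (5 / ε) = 4 / 5 * ε := by field_simp
  rw [this]
  linarith

/-- Prokhorov's theorem for a sequence of random analytic functions: the space of analytic functions
is metrizable and separable, so that relatively compact sets of laws are sequentially compact. -/
theorem exists_tendstoInDistribution {Ω : ℕ → Type u} [∀ n, MeasurableSpace (Ω n)]
    {P : ∀ n, Measure (Ω n)} [∀ n, IsProbabilityMeasure (P n)] {f : ∀ n, Ω n → HolDisk}
    (hf : ∀ n, AEMeasurable (f n) (P n))
    (h : ∀ ε : ℝ, 0 < ε → ∃ K : Set HolDisk, IsCompact K ∧ ∀ n, 1 ≤ n →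
      1 - ε < (P n).real {ω | f n ω ∈ K}) {φ : ℕ → ℕ} (hφ : StrictMono φ) :
    ∃ ψ : ℕ → ℕ, StrictMono ψ ∧ ∃ μ : ProbabilityMeasure HolDisk,
      TendstoInDistribution (fun j ω => f (φ (ψ j)) ω) atTop (id : HolDisk → HolDisk)
        (fun j => P (φ (ψ j))) (μ : Measure HolDisk) := by
  let ν : ℕ → ProbabilityMeasure HolDisk := fun n =>
    ⟨(P n).map (f n), Measure.isProbabilityMeasure_map (hf n)⟩
  -- The index is shifted by one so that `φ` only takes positive values.
  have htight : IsTightMeasureSet {((μ : ProbabilityMeasure HolDisk) : Measure HolDisk) |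
      μ ∈ Set.range fun j => ν (φ (j + 1))} := by
    rw [isTightMeasureSet_iff_exists_isCompact_measure_compl_le]
    intro ε hε
    rcases eq_or_ne ε ⊤ with rfl | hε'
    · exact ⟨∅, isCompact_empty, fun _ _ => le_top⟩
    obtain ⟨K, hK, hKP⟩ := h ε.toReal (ENNReal.toReal_pos hε.ne' hε')
    refine ⟨K, hK, ?_⟩
    rintro _ ⟨_, ⟨j, rfl⟩, rfl⟩
    have hj : 1 ≤ φ (j + 1) := (Nat.le_add_left 1 j).trans (hφ.id_le (j + 1))
    have hKm : MeasurableSet K := hK.isClosed.measurableSet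
    have h1 : ((P (φ (j + 1))).map (f (φ (j + 1)))).real K
        = (P (φ (j + 1))).real {ω | f (φ (j + 1)) ω ∈ K} :=
      map_measureReal_apply_of_aemeasurable (hf _) hKm
    have hprob : IsProbabilityMeasure ((P (φ (j + 1))).map (f (φ (j + 1)))) :=
      Measure.isProbabilityMeasure_map (hf _)
    have h2 := hKP _ hj
    rw [← h1] at h2
    have h3 := probReal_compl_eq_one_sub (μ := (P (φ (j + 1))).map (f (φ (j + 1)))) hKm
    show ((P (φ (j + 1))).map (f (φ (j + 1)))) Kᶜ ≤ ε
    rw [← ENNReal.toReal_le_toReal (measure_ne_top _ _) hε']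
    show ((P (φ (j + 1))).map (f (φ (j + 1)))).real Kᶜ ≤ ε.toReal
    linarith
  obtain ⟨μ, -, ψ, hψ, hlim⟩ := (isCompact_closure_of_isTightMeasureSet htight).isSeqCompact
    (x := fun j => ν (φ (j + 1))) fun j => subset_closure ⟨j, rfl⟩
  refine ⟨fun j => ψ j + 1, fun a b hab => Nat.succ_lt_succ (hψ hab), μ,
    fun j => hf _, measurable_id.aemeasurable, ?_⟩
  have hμ : (⟨(μ : Measure HolDisk).map id, Measure.isProbabilityMeasure_map
      measurable_id.aemeasurable⟩ : ProbabilityMeasure HolDisk) = μ :=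
    Subtype.ext Measure.map_id
  rw [hμ]
  exact hlim

end PermSum

theorem mainTheorem6 :
    -- second moments of the secular coefficients
    (∀ (n d : ℕ) (r : ℝ) (Ω : Type u) [MeasurableSpace Ω] (P : Measure Ω) [IsProbabilityMeasure P]
        (π : Fin d → Ω → Equiv.Perm (Fin n)),
        IsIIDUniformPerms P π → 2 ≤ n → 0 < r → r < 1 → 1 ≤ d →
        (d : ℝ) < Real.sqrt (n * (1 - r) / r) →
        (∑ k ∈ Finset.range (n + 1), r ^ k / (d : ℝ) ^ (k + 1) *
            ∫ ω, |secularCoeff (permMatrixSum fun q => π q ω) k| ^ 2 ∂P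
          ≤ (2 / (d : ℝ) + r) / (1 - r - r * (d : ℝ) ^ 2 / n) ^ 2) ∧
        (∑ k ∈ Finset.Icc 1 n, r ^ k / (d : ℝ) ^ k *
            ∑ I ∈ Finset.powersetCard k (Finset.univ : Finset (Fin n)),
              ∫ ω, principalMinor (permMatrixSum fun q => π q ω) I ^ 2 ∂P
          ≤ 2 / (1 - r - r * (d : ℝ) ^ 2 / n)) ∧
        (∑ k ∈ Finset.Icc 1 n, r ^ k / (d : ℝ) ^ (k + 1) *
            |∑ I ∈ Finset.powersetCard k (Finset.univ : Finset (Fin n)),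
              ∑ J ∈ (Finset.powersetCard k (Finset.univ : Finset (Fin n))).filter
                  (fun J => (I ∩ J).card = k - 1),
                ∫ ω, principalMinor (permMatrixSum fun q => π q ω) I *
                  principalMinor (permMatrixSum fun q => π q ω) J ∂P|
          ≤ r / (1 - r - r * (d : ℝ) ^ 2 / n) ^ 2)) ∧
    -- tightness and subsequential convergence in law
    (∀ (d : ℕ → ℕ) (Ω : ℕ → Type u) [∀ n, MeasurableSpace (Ω n)] (P : ∀ n, Measure (Ω n))
        [∀ n, IsProbabilityMeasure (P n)]
        (π : ∀ n, Fin (d n) → Ω n → Equiv.Perm (Fin n)),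
        (∀ n, IsIIDUniformPerms (P n) (π n)) → (∀ n, 1 ≤ n → 1 ≤ d n) →
        (fun n => (d n : ℝ)) =o[atTop] (fun n : ℕ => Real.sqrt n) →
        IsTightSeq P (fun n ω => rescaledCharpolyHol (d n) (permMatrixSum fun q => π n q ω)) ∧
        ∀ φ : ℕ → ℕ, StrictMono φ → ∃ ψ : ℕ → ℕ, StrictMono ψ ∧ ∃ μ : ProbabilityMeasure HolDisk,
          TendstoInDistribution
            (fun j ω => rescaledCharpolyHol (d (φ (ψ j)))
              (permMatrixSum fun q => π (φ (ψ j)) q ω))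
            atTop (id : HolDisk → HolDisk) (fun j => P (φ (ψ j))) (μ : Measure HolDisk)) := by
  refine ⟨?_, ?_⟩
  · intro n d r Ω _ P _ π hπ hn h0 h1 hd hdr
    have hn' : 0 < n := by omega
    refine ⟨?_, ?_, ?_⟩
    · have h := PermSum.sum_expect_secularCoeff_sq_le hn' h0 h1 hd hdr
      simp only [← PermSum.integral_eq_expect hπ] at h
      simpa only [sq_abs] using h
    · have h := PermSum.sum_sum_expect_principalMinor_sq_le hn' h0 h1 hd hdr
      simpa only [← PermSum.integral_eq_expect hπ] using h
    · have h := PermSum.sum_abs_sum_expect_principalMinor_mul_le hn' h0 h1 hd hdr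
      simpa only [← PermSum.integral_eq_expect hπ] using h
  · intro d Ω _ P _ π hπ hd _
    refine ⟨fun ε hε => ?_, fun φ hφ => ?_⟩
    · obtain ⟨K, hK, h⟩ := PermSum.exists_isCompact_forall_lt hπ hd hε
      exact ⟨K, hK, eventually_atTop.2 ⟨1, h⟩⟩
    · exact PermSum.exists_tendstoInDistribution
        (fun n => (PermSum.measurable_comp_perms (hπ n)
          fun σ => rescaledCharpolyHol (d n) (permMatrixSum σ)).aemeasurable)
        (fun ε hε => PermSum.exists_isCompact_forall_lt hπ hd hε) hφ
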